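/- For a real number $\beta>1$, let $T_{-\beta}:(0,1]\to(0,1]$ be the $(-\beta)$-transformation $T_{-\beta}(x)=-\beta x+\lfloor\beta x\rfloor+1$. A measure-preserving transformation $T$ of a probability space $(X,\mathcal B,\mu)$ is called exact if for every set $A$ with $\mu(A)>0$ and $T^n(A)\in\mathcal B$ for all $n\ge 0$, one has $\lim_{n\to\infty}\mu(T^n(A))=1$. For every real $\beta>1$, there is exactly one Borel probability measure $\mu$ on $(0,1]$ that is absolutely continuous with respect to Lebesgue measure and invariant under $T_{-\beta}$, and $T_{-\beta}$ is exact with respect to this measure $\mu$. -/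

import Mathlib

open MeasureTheory Set Filter Topology

/-- The `(-β)`-transformation `x ↦ -β x + ⌊β x⌋ + 1` of the half-open interval `(0, 1]`. -/
noncomputable def negBetaMap (β : ℝ) (x : Ioc (0 : ℝ) 1) : Ioc (0 : ℝ) 1 :=
  ⟨-β * (x : ℝ) + (⌊β * (x : ℝ)⌋ : ℝ) + 1, by
    have h₁ := Int.floor_le (β * (x : ℝ))
    have h₂ := Int.lt_floor_add_one (β * (x : ℝ))
    constructor <;> linarith⟩

/-- Lebesgue measure on the Borel subsets of `(0, 1]`. -/
noncomputable def lebesgueIoc : Measure (Ioc (0 : ℝ) 1) :=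
  (volume : Measure ℝ).comap Subtype.val

/-- `μ` is a `T`-invariant probability measure, absolutely continuous with respect to the
reference measure `m`. -/
structure IsACInvariantMeasure {X : Type*} [MeasurableSpace X] (T : X → X) (m μ : Measure X) :
    Prop where
  isProbabilityMeasure : IsProbabilityMeasure μ
  absolutelyContinuous : μ ≪ m
  measurePreserving : MeasurePreserving T μ μ

/-- A measure-preserving transformation `T` of a probability space is exact if, for each set `A`
of positive measure all of whose forward images `T^n(A)`, `n ≥ 0`, are measurable, the measure
of `T^n(A)` tends to `1`. -/
structure IsExactMap {X : Type*} [MeasurableSpace X] (T : X → X) (μ : Measure X) : Prop where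
  isProbabilityMeasure : IsProbabilityMeasure μ
  measurePreserving : MeasurePreserving T μ μ
  tendsto_measure_image : ∀ A : Set X, (∀ n : ℕ, MeasurableSet (T^[n] '' A)) → 0 < μ A →
    Tendsto (fun n : ℕ => μ (T^[n] '' A)) atTop (𝓝 1)

/-! Write f for the map, λ for Lebesgue measure. On each piece between consecutive points d/β, f is
affine of slope -β; expansion drives the dynamics.

Covering: an interval avoiding every d/β is stretched by β, so some iterate must straddle a
discontinuity; its next image contains one-sided neighbourhoods of 0 and 1. This yields an interval
G = (0, ε) with G ⊆ fⁿ(G) for all large n.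

Exactness: if every image of A missed a fixed amount of G, pulling back along affine branches would
make A miss a fixed proportion of every interval, against Lebesgue density. So some fⁿ(A) nearly
fills G (`exists_attracting_interval`). If μ is an absolutely continuous invariant probability,
almost every point enters ⋃ fᵐ(G), so a single later image of G, hence of A, has μ-measure near 1
(`exists_iterate_image_measure_gt`). As μ(fⁿ(A)) never decreases, f is exact; it is also ergodic,
and averaging two invariant measures gives uniqueness.

Existence: the signed measure Σ (-β)⁻ᵏ λ|(0, fᵏ(1)] is invariant (`orbitMeasure_balance`) and
nonzero (`orbitMeasure_zero_ne_one`). The positive part of it or of its negative is, once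
normalized, the required measure. -/

/-! ### Affine branches and images of intervals -/

/-- The formula of the `(-β)`-transformation on the whole real line. -/
noncomputable def negBetaReal (β x : ℝ) : ℝ := -β * x + (⌊β * x⌋ : ℝ) + 1

lemma negBetaReal_mem_Ioc (β x : ℝ) : negBetaReal β x ∈ Ioc (0 : ℝ) 1 := by
  have h₁ := Int.floor_le (β * x)
  have h₂ := Int.lt_floor_add_one (β * x)
  constructor <;> unfold negBetaReal <;> linarith

lemma negBetaReal_eq_of_floor {β x : ℝ} {d : ℤ} (h₁ : (d : ℝ) ≤ β * x) (h₂ : β * x < d + 1) :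
    negBetaReal β x = -β * x + (d + 1) := by
  have : ⌊β * x⌋ = d := Int.floor_eq_iff.mpr ⟨h₁, h₂⟩
  rw [negBetaReal, this, add_assoc]

lemma iterate_negBetaReal_mem_Ioc {β x : ℝ} (hx : x ∈ Ioc (0 : ℝ) 1) (n : ℕ) :
    (negBetaReal β)^[n] x ∈ Ioc (0 : ℝ) 1 := by
  cases n with
  | zero => exact hx
  | succ n => rw [Function.iterate_succ_apply']; exact negBetaReal_mem_Ioc _ _

lemma Ioo_subset_Ioo_of_subset_Ioc {a b : ℝ} (h : Ioo a b ⊆ Ioc 0 1) : Ioo a b ⊆ Ioo 0 1 := by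
  intro x hx
  refine ⟨(h hx).1, lt_of_le_of_ne (h hx).2 fun hx1 => ?_⟩
  have := (h (show (x + b) / 2 ∈ Ioo a b from ⟨by linarith [hx.1, hx.2], by linarith [hx.2]⟩)).2
  linarith [hx.2]

lemma sub_le_one_of_Ioo_subset {a b : ℝ} (h : Ioo a b ⊆ Ioc 0 1) : b - a ≤ 1 := by
  rcases lt_or_ge a b with hab | hab
  · have h' : Ioo a b ⊆ Icc 0 1 := h.trans Ioc_subset_Icc_self
    have h2 := closure_minimal h' isClosed_Icc
    rw [closure_Ioo hab.ne] at h2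
    have := (h2 (left_mem_Icc.mpr hab.le)).1
    have := (h2 (right_mem_Icc.mpr hab.le)).2
    linarith
  · linarith

lemma exists_image_Ioo_of_affine {g : ℝ → ℝ} {s c a b : ℝ} (hs : s ≠ 0)
    (hg : ∀ x ∈ Ioo a b, g x = s * x + c) :
    ∃ a' b', g '' Ioo a b = Ioo a' b' ∧ b' - a' = |s| * (b - a) := by
  have key : g '' Ioo a b = (fun x => s * x + c) '' Ioo a b := image_congr hg
  rw [key]
  rcases lt_or_gt_of_ne hs with h | h
  · refine ⟨s * b + c, s * a + c, ?_, by rw [abs_of_neg h]; ring⟩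
    ext y
    simp only [mem_image, mem_Ioo]
    constructor
    · rintro ⟨x, ⟨h1, h2⟩, rfl⟩
      exact ⟨by nlinarith, by nlinarith⟩
    · rintro ⟨h1, h2⟩
      refine ⟨(y - c) / s, ⟨?_, ?_⟩, by field_simp; ring⟩
      · rw [lt_div_iff_of_neg h]; linarith
      · rw [div_lt_iff_of_neg h]; linarith
  · refine ⟨s * a + c, s * b + c, ?_, by rw [abs_of_pos h]; ring⟩
    ext y
    simp only [mem_image, mem_Ioo]
    constructor
    · rintro ⟨x, ⟨h1, h2⟩, rfl⟩
      exact ⟨by nlinarith, by nlinarith⟩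
    · rintro ⟨h1, h2⟩
      refine ⟨(y - c) / s, ⟨?_, ?_⟩, by field_simp; ring⟩
      · rw [lt_div_iff₀ h]; linarith
      · rw [div_lt_iff₀ h]; linarith

lemma exists_affine_of_forall_int {β a b : ℝ} (hβ : 0 < β)
    (h : ∀ d : ℤ, (d : ℝ) / β ∉ Ioo a b) :
    ∃ c, ∀ x ∈ Ioo a b, negBetaReal β x = -β * x + c := by
  by_cases hab : (Ioo a b).Nonempty
  · obtain ⟨z, hz⟩ := hab
    refine ⟨⌊β * z⌋ + 1, fun x hx => negBetaReal_eq_of_floor ?_ ?_⟩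
    · by_contra! hlt
      refine h ⌊β * z⌋ ⟨hx.1.trans ?_, lt_of_le_of_lt ?_ hz.2⟩
      · rw [lt_div_iff₀ hβ]; linarith
      · rw [div_le_iff₀ hβ]; linarith [Int.floor_le (β * z)]
    · by_contra! hlt
      refine h (⌊β * z⌋ + 1) ⟨hz.1.trans ?_, lt_of_le_of_lt ?_ hx.2⟩
      · rw [lt_div_iff₀ hβ]; push_cast; linarith [Int.lt_floor_add_one (β * z)]
      · rw [div_le_iff₀ hβ]; push_cast; linarith
  · exact ⟨0, fun x hx => absurd ⟨x, hx⟩ hab⟩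

/-- At d/β the map tends to 0 from the left and to 1 from the right, so the two sides of the point
cover the two ends of (0, 1). -/
lemma image_Ioo_of_discontinuity {β a b : ℝ} (hβ : 0 < β) {d : ℤ} (h : (d : ℝ) / β ∈ Ioo a b) :
    ∃ ε, 0 < ε ∧ ε ≤ 1 ∧ Ioo 0 ε ∪ Ioo (1 - ε) 1 ⊆ negBetaReal β '' Ioo a b := by
  obtain ⟨h1, h2⟩ := h
  have h1' : 0 < β * (d / β - a) := mul_pos hβ (by linarith)
  have h2' : 0 < β * (b - d / β) := mul_pos hβ (by linarith)
  have hd : β * (d / β) = d := by field_simp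
  rw [mul_sub, hd] at h1' h2'
  refine ⟨min 1 (min (d - β * a) (β * b - d)), by simp only [lt_min_iff]; exact
    ⟨one_pos, h1', h2'⟩, min_le_left _ _, ?_⟩
  rintro y (⟨hy1, hy2⟩ | ⟨hy1, hy2⟩)
  · simp only [lt_min_iff] at hy2
    have e : β * ((d - y) / β) = d - y := by field_simp
    refine ⟨(d - y) / β, ⟨?_, ?_⟩, ?_⟩
    · rw [lt_div_iff₀ hβ]; linarith
    · rw [div_lt_iff₀ hβ]; linarith
    · rw [negBetaReal_eq_of_floor (d := d - 1)]
      · push_cast; linarith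
      · push_cast; linarith
      · push_cast; linarith
  · have hy3 := sub_lt_comm.mp hy1
    simp only [lt_min_iff] at hy3
    have e : β * ((d + (1 - y)) / β) = d + (1 - y) := by field_simp
    refine ⟨(d + (1 - y)) / β, ⟨?_, ?_⟩, ?_⟩
    · rw [lt_div_iff₀ hβ]; linarith
    · rw [div_lt_iff₀ hβ]; linarith
    · rw [negBetaReal_eq_of_floor (d := d)]
      · linarith
      · linarith
      · linarith

lemma image_iterate_subset_Ioc {β : ℝ} {E : Set ℝ} (hE : E ⊆ Ioc 0 1) (n : ℕ) :
    (negBetaReal β)^[n] '' E ⊆ Ioc 0 1 := by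
  rintro _ ⟨x, hx, rfl⟩
  exact iterate_negBetaReal_mem_Ioc (hE hx) n

lemma image_iterate_add_subset {f : ℝ → ℝ} {A B C : Set ℝ} {m n : ℕ} (h₁ : B ⊆ f^[n] '' A)
    (h₂ : C ⊆ f^[m] '' B) : C ⊆ f^[m + n] '' A := by
  rw [Function.iterate_add, image_comp]
  exact h₂.trans (image_mono h₁)

/-! ### Covering properties of iterated intervals -/

/-- Some iterate of every interval covers one-sided neighbourhoods of both `0` and `1`. -/
lemma exists_iterate_image_endpoints {β a b : ℝ} (hβ : 1 < β) (hab : a < b)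
    (h01 : Ioo a b ⊆ Ioo 0 1) :
    ∃ n : ℕ, ∃ ε, 0 < ε ∧ ε ≤ 1 ∧
      Ioo 0 ε ∪ Ioo (1 - ε) 1 ⊆ (negBetaReal β)^[n + 1] '' Ioo a b := by
  have hβ0 : 0 < β := by linarith
  by_contra! hcon
  -- As long as no image meets a point d/β, each step multiplies the length by β; this cannot last
  -- inside (0, 1].
  have grow : ∀ n : ℕ, ∃ a' b', Ioo a' b' ⊆ (negBetaReal β)^[n] '' Ioo a b ∧
      b' - a' = β ^ n * (b - a) := by
    intro n
    induction n with
    | zero => exact ⟨a, b, by simp, by simp⟩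
    | succ n ih =>
      obtain ⟨a', b', hsub, hlen⟩ := ih
      have hno : ∀ d : ℤ, (d : ℝ) / β ∉ Ioo a' b' := by
        intro d hd
        obtain ⟨ε, h0, h1, hε⟩ := image_Ioo_of_discontinuity hβ0 hd
        refine hcon n ε h0 h1 (add_comm 1 n ▸ image_iterate_add_subset hsub ?_)
        simpa using hε
      obtain ⟨c, hc⟩ := exists_affine_of_forall_int hβ0 hno
      obtain ⟨a'', b'', him, hl⟩ := exists_image_Ioo_of_affine (neg_ne_zero.mpr hβ0.ne') hc
      refine ⟨a'', b'', ?_, ?_⟩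
      · rw [add_comm]
        refine image_iterate_add_subset hsub ?_
        simp [him]
      · rw [hl, hlen, abs_neg, abs_of_pos hβ0]; ring
  obtain ⟨n, hn⟩ := pow_unbounded_of_one_lt (1 / (b - a)) hβ
  obtain ⟨a', b', hsub, hlen⟩ := grow n
  have := sub_le_one_of_Ioo_subset
    (hsub.trans (image_iterate_subset_Ioc (h01.trans Ioo_subset_Ioc_self) n))
  rw [div_lt_iff₀ (by linarith)] at hn
  linarith

/-- The iterates of the map are affine off a finite set. -/
lemma exists_finite_affine {β : ℝ} (hβ : 1 < β) (k : ℕ) :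
    ∃ D : Set ℝ, D.Finite ∧ ∀ a b, Ioo a b ⊆ Ioo 0 1 → Disjoint (Ioo a b) D →
      ∃ c, ∀ x ∈ Ioo a b, (negBetaReal β)^[k] x = (-β) ^ k * x + c := by
  have hβ0 : 0 < β := by linarith
  induction k with
  | zero => exact ⟨∅, finite_empty, fun a b _ _ => ⟨0, by simp⟩⟩
  | succ k ih =>
    obtain ⟨D, hD, h⟩ := ih
    have hbr : ∀ x ∈ Ioo (0 : ℝ) 1, ⌊β * x⌋ ∈ Icc (0 : ℤ) ⌈β⌉ := by
      intro x hx
      refine ⟨Int.floor_nonneg.mpr (by nlinarith [hx.1]), ?_⟩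
      have : (⌊β * x⌋ : ℝ) ≤ (⌈β⌉ : ℝ) :=
        (Int.floor_le _).trans ((by nlinarith [hx.2] : β * x ≤ β).trans (Int.le_ceil β))
      exact_mod_cast this
    -- New breakpoints: those of f, and the preimages (d + 1 - y)/β of the old ones y under the
    -- branches x ↦ -βx + d + 1.
    refine ⟨(fun d : ℤ => (d : ℝ) / β) '' Icc 0 ⌈β⌉ ∪
      image2 (fun (d : ℤ) (y : ℝ) => ((d : ℝ) + 1 - y) / β) (Icc 0 ⌈β⌉) D,
      ((finite_Icc _ _).image _).union ((finite_Icc _ _).image2 _ hD), fun a b h01 hdis => ?_⟩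
    rw [disjoint_union_right, disjoint_left, disjoint_left] at hdis
    have hno : ∀ d : ℤ, (d : ℝ) / β ∉ Ioo a b := by
      intro d hd
      refine hdis.1 hd ⟨d, ?_, rfl⟩
      have := hbr _ (h01 hd)
      rwa [mul_div_cancel₀ _ hβ0.ne', Int.floor_intCast] at this
    obtain ⟨c, hc⟩ := exists_affine_of_forall_int hβ0 hno
    obtain ⟨a', b', him, -⟩ := exists_image_Ioo_of_affine (neg_ne_zero.mpr hβ0.ne') hc
    have h01' : Ioo a' b' ⊆ Ioo 0 1 := by
      refine Ioo_subset_Ioo_of_subset_Ioc ?_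
      rw [← him]
      rintro _ ⟨x, -, rfl⟩
      exact negBetaReal_mem_Ioc β x
    obtain ⟨c', hc'⟩ := h a' b' h01' (by
      rw [← him, disjoint_left]
      rintro _ ⟨x, hx, rfl⟩ hxD
      refine hdis.2 hx ⟨_, hbr x (h01 hx), _, hxD, ?_⟩
      rw [div_eq_iff hβ0.ne', negBetaReal]
      ring)
    refine ⟨(-β) ^ k * c + c', fun x hx => ?_⟩
    rw [Function.iterate_succ_apply, hc' _ (him ▸ mem_image_of_mem _ hx), hc x hx]
    ring

lemma exists_separation {D : Set ℝ} (hD : D.Finite) :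
    ∃ δ > 0, ∀ x ∈ D, ∀ y ∈ D, x ≠ y → δ ≤ |x - y| := by
  obtain ⟨δ, h0, h1⟩ := ENNReal.lt_iff_exists_nnreal_btwn.mp hD.einfsep_pos
  refine ⟨δ, by exact_mod_cast h0, fun x hx y hy hxy => ?_⟩
  have := h1.le.trans (Set.einfsep_le_edist_of_mem hx hy hxy)
  rw [edist_dist, Real.dist_eq, ENNReal.le_ofReal_iff_toReal_le ENNReal.coe_ne_top (abs_nonneg _)]
    at this
  simpa using this

/-- For a suitable iterate with slope exceeding `2`, short intervals meet at most one
discontinuity. -/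
lemma exists_iterate_two_branches {β : ℝ} (hβ : 1 < β) :
    ∃ k : ℕ, ∃ δ > 0, 2 < β ^ k ∧ ∀ a b, a < b → Ioo a b ⊆ Ioo 0 1 → b - a < δ →
      ∃ m ∈ Icc a b, (∃ c, ∀ x ∈ Ioo a m, (negBetaReal β)^[k] x = (-β) ^ k * x + c) ∧
        ∃ c, ∀ x ∈ Ioo m b, (negBetaReal β)^[k] x = (-β) ^ k * x + c := by
  obtain ⟨k, hk⟩ := pow_unbounded_of_one_lt 2 hβ
  obtain ⟨D, hD, hDa⟩ := exists_finite_affine hβ k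
  obtain ⟨δ, hδ, hsep⟩ := exists_separation hD
  refine ⟨k, δ, hδ, hk, fun a b hab h01 hlen => ?_⟩
  obtain ⟨m, hm, hm'⟩ : ∃ m ∈ Icc a b, ∀ x ∈ Ioo a b, x ∈ D → x = m := by
    by_cases hne : ∃ m ∈ Ioo a b, m ∈ D
    · obtain ⟨m, hm, hmD⟩ := hne
      refine ⟨m, Ioo_subset_Icc_self hm, fun x hx hxD => ?_⟩
      by_contra hxm
      have := hsep x hxD m hmD hxm
      rcases abs_cases (x - m) with h | h <;> linarith [hx.1, hx.2, hm.1, hm.2]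
    · push Not at hne
      exact ⟨a, left_mem_Icc.mpr hab.le, fun x hx hxD => absurd hxD (hne x hx)⟩
  have hl : Ioo a m ⊆ Ioo a b := Ioo_subset_Ioo_right hm.2
  have hr : Ioo m b ⊆ Ioo a b := Ioo_subset_Ioo_left hm.1
  refine ⟨m, hm, hDa _ _ (hl.trans h01) ?_, hDa _ _ (hr.trans h01) ?_⟩
  · rw [disjoint_left]
    exact fun x hx hxD => hx.2.ne (hm' x (hl hx) hxD)
  · rw [disjoint_left]
    exact fun x hx hxD => hx.1.ne' (hm' x (hr hx) hxD)

/-- Some iterate of every interval contains an interval of length at least `δ`. -/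
lemma exists_iterate_image_long {β : ℝ} {k : ℕ} {δ : ℝ} (hk : 2 < β ^ k) (hβ : 1 < β)
    (hsplit : ∀ a b, a < b → Ioo a b ⊆ Ioo 0 1 → b - a < δ →
      ∃ m ∈ Icc a b, (∃ c, ∀ x ∈ Ioo a m, (negBetaReal β)^[k] x = (-β) ^ k * x + c) ∧
        ∃ c, ∀ x ∈ Ioo m b, (negBetaReal β)^[k] x = (-β) ^ k * x + c)
    {a b : ℝ} (hab : a < b) (h01 : Ioo a b ⊆ Ioo 0 1) :
    ∃ n : ℕ, ∃ a' b', δ ≤ b' - a' ∧ Ioo a' b' ⊆ (negBetaReal β)^[n] '' Ioo a b := by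
  have hβ0 : 0 < β := by linarith
  by_contra! hcon
  have hs : (-β) ^ k ≠ 0 := pow_ne_zero _ (neg_ne_zero.mpr hβ0.ne')
  have habs : |(-β) ^ k| = β ^ k := by rw [abs_pow, abs_neg, abs_of_pos hβ0]
  have hq : 1 < β ^ k / 2 := by linarith
  have himage : ∀ n : ℕ, (negBetaReal β)^[n] '' Ioo a b ⊆ Ioc 0 1 :=
    image_iterate_subset_Ioc (h01.trans Ioo_subset_Ioc_self)
  -- A short interval is cut into at most two affine pieces; keeping the longer one gains a factor β
  -- ^ k / 2 > 1.
  have grow : ∀ j : ℕ, ∃ n : ℕ, ∃ a' b', (β ^ k / 2) ^ j * (b - a) ≤ b' - a' ∧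
      Ioo a' b' ⊆ (negBetaReal β)^[n] '' Ioo a b := by
    intro j
    induction j with
    | zero => exact ⟨0, a, b, by simp, by simp⟩
    | succ j ih =>
      obtain ⟨n, a', b', hlen, hsub⟩ := ih
      have hpos : 0 < (β ^ k / 2) ^ j * (b - a) :=
        mul_pos (pow_pos (by linarith) _) (by linarith)
      obtain ⟨m, hm, ⟨c₁, hc₁⟩, c₂, hc₂⟩ := hsplit a' b' (by linarith)
        (Ioo_subset_Ioo_of_subset_Ioc (hsub.trans (himage n)))
        (by
          by_contra! hle
          exact hcon n a' b' hle hsub)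
      obtain ⟨p₁, q₁, him₁, hl₁⟩ := exists_image_Ioo_of_affine hs hc₁
      obtain ⟨p₂, q₂, him₂, hl₂⟩ := exists_image_Ioo_of_affine hs hc₂
      rw [habs] at hl₁ hl₂
      have hpow : (β ^ k / 2) ^ (j + 1) * (b - a) = β ^ k * (((β ^ k / 2) ^ j * (b - a)) / 2) := by
        ring
      rcases le_total ((b' - a') / 2) (m - a') with hh | hh
      · refine ⟨k + n, p₁, q₁, ?_, image_iterate_add_subset hsub ?_⟩
        · rw [hl₁, hpow]; gcongr; linarith
        · rw [← him₁]; exact image_mono (Ioo_subset_Ioo_right hm.2)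
      · refine ⟨k + n, p₂, q₂, ?_, image_iterate_add_subset hsub ?_⟩
        · rw [hl₂, hpow]; gcongr; linarith
        · rw [← him₂]; exact image_mono (Ioo_subset_Ioo_left hm.1)
  obtain ⟨j, hj⟩ := pow_unbounded_of_one_lt (1 / (b - a)) hq
  obtain ⟨n, a', b', hlen, hsub⟩ := grow j
  have := sub_le_one_of_Ioo_subset (hsub.trans (himage n))
  rw [div_lt_iff₀ (by linarith)] at hj
  linarith

/-- There is one interval `(0, ε)` that is covered by an iterate of every interval of length at
least `δ`, with finitely many iteration times needed. -/
lemma exists_uniform_endpoint_interval {β δ : ℝ} (hβ : 1 < β) (hδ : 0 < δ) :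
    ∃ ε, 0 < ε ∧ ε ≤ 1 ∧ ∃ M : ℕ, ∀ a b, δ ≤ b - a → Ioo a b ⊆ Ioo 0 1 →
      ∃ n ≤ M, Ioo 0 ε ⊆ (negBetaReal β)^[n] '' Ioo a b := by
  obtain ⟨N, hN⟩ := exists_nat_gt (2 / δ)
  have hN0 : (0 : ℝ) < N := lt_trans (by positivity) hN
  -- With cells of length 1/N < δ/2, every interval of length at least δ contains a whole cell, so
  -- finitely many cells decide ε and M.
  have hN2 : 2 / (N : ℝ) < δ := by
    rw [div_lt_iff₀ hδ] at hN
    rw [div_lt_iff₀ hN0]; linarith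
  have hcell : ∀ i : ℕ, i < N → ∃ n : ℕ, ∃ ε, 0 < ε ∧ ε ≤ 1 ∧
      Ioo 0 ε ⊆ (negBetaReal β)^[n] '' Ioo ((i : ℝ) / N) ((i + 1 : ℝ) / N) := by
    intro i hi
    have hi' : (i + 1 : ℝ) ≤ N := by exact_mod_cast hi
    obtain ⟨n, ε, h0, h1, h⟩ := exists_iterate_image_endpoints hβ
      (a := (i : ℝ) / N) (b := (i + 1 : ℝ) / N) (by gcongr; linarith)
      (Ioo_subset_Ioo (by positivity) (by rw [div_le_one hN0]; exact hi'))
    exact ⟨n + 1, ε, h0, h1, subset_union_left.trans h⟩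
  have huni : ∀ r : ℕ, r ≤ N → ∃ ε, 0 < ε ∧ ε ≤ 1 ∧ ∃ M : ℕ, ∀ i < r, ∃ n ≤ M,
      Ioo 0 ε ⊆ (negBetaReal β)^[n] '' Ioo ((i : ℝ) / N) ((i + 1 : ℝ) / N) := by
    intro r
    induction r with
    | zero => exact fun _ => ⟨1, one_pos, le_rfl, 0, fun i hi => absurd hi (Nat.not_lt_zero i)⟩
    | succ r ih =>
      intro hr
      obtain ⟨ε, h0, h1, M, hM⟩ := ih (by omega)
      obtain ⟨n', ε', h0', h1', h'⟩ := hcell r hr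
      refine ⟨min ε ε', lt_min h0 h0', min_le_of_left_le h1, max M n', fun i hi => ?_⟩
      rcases Nat.lt_succ_iff_lt_or_eq.mp hi with hi | rfl
      · obtain ⟨n, hn, h⟩ := hM i hi
        exact ⟨n, le_max_of_le_left hn, (Ioo_subset_Ioo_right (min_le_left _ _)).trans h⟩
      · exact ⟨n', le_max_right _ _, (Ioo_subset_Ioo_right (min_le_right _ _)).trans h'⟩
  obtain ⟨ε, h0, h1, M, hM⟩ := huni N le_rfl
  refine ⟨ε, h0, h1, M, fun a b hlen h01 => ?_⟩
  have hab : a < b := by linarith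
  have hcl := closure_mono h01
  rw [closure_Ioo hab.ne, closure_Ioo one_ne_zero.symm] at hcl
  have ha : 0 ≤ a := (hcl (left_mem_Icc.mpr hab.le)).1
  have hb : b ≤ 1 := (hcl (right_mem_Icc.mpr hab.le)).2
  have e1 := Nat.le_ceil (a * N)
  have e2 := Nat.ceil_lt_add_one (a := a * N) (by positivity)
  have hNδ : 2 < δ * N := by rwa [div_lt_iff₀ hN0] at hN2
  have hstep : ((⌈a * N⌉₊ : ℝ) + 1) < b * N := by nlinarith
  obtain ⟨n, hn, h⟩ := hM ⌈a * N⌉₊ (by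
    have : ((⌈a * N⌉₊ : ℝ)) < N := by nlinarith
    exact_mod_cast this)
  refine ⟨n, hn, h.trans (image_mono (Ioo_subset_Ioo ?_ ?_))⟩
  · rwa [le_div_iff₀ hN0]
  · rw [div_le_iff₀ hN0]; exact hstep.le

lemma image_Ioo_zero {β ε : ℝ} (hβ : 0 < β) (hε : ε ≤ 1) :
    negBetaReal β '' Ioo 0 (ε / β) ⊆ Ioo (1 - ε) 1 := by
  rintro _ ⟨x, ⟨h1, h2⟩, rfl⟩
  rw [lt_div_iff₀ hβ] at h2
  have := mul_pos hβ h1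
  rw [negBetaReal_eq_of_floor (d := 0)] <;> push_cast
  · constructor <;> linarith
  · linarith
  · linarith

/-- If `f^K(G)` contains both `G` and `f(G)`, then `f^n(G)` contains `G` for all large `n`. -/
lemma subset_iterate_image_of_consecutive {f : ℝ → ℝ} {G : Set ℝ} {K : ℕ} (hK : 0 < K)
    (h₀ : G ⊆ f^[K] '' G) (h₁ : f '' G ⊆ f^[K] '' G) :
    ∀ n ≥ K * K, G ⊆ f^[n] '' G := by
  have hmul : ∀ j : ℕ, G ⊆ f^[j * K] '' G := by
    intro j
    induction j with
    | zero => simp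
    | succ j ih =>
      rw [add_mul, one_mul, add_comm]
      exact image_iterate_add_subset ih h₀
  have hmix : ∀ j i : ℕ, i ≤ j → f^[i] '' G ⊆ f^[j * K] '' G := by
    intro j
    induction j with
    | zero => intro i hi; simp [Nat.le_zero.mp hi]
    | succ j ih =>
      intro i hi
      rw [add_mul, one_mul]
      rcases i with _ | i
      · have := hmul (j + 1)
        rw [add_mul, one_mul] at this
        simpa using this
      · have hi' := ih i (by omega)
        calc f^[i + 1] '' G = f '' (f^[i] '' G) := by
              rw [Function.iterate_succ', image_comp]
          _ ⊆ f '' (f^[j * K] '' G) := image_mono hi'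
          _ = f^[j * K] '' (f '' G) := by
              rw [← image_comp, ← image_comp, ← Function.iterate_succ, ← Function.iterate_succ']
          _ ⊆ f^[j * K] '' (f^[K] '' G) := image_mono h₁
          _ = f^[j * K + K] '' G := by rw [Function.iterate_add, image_comp]
  intro n hn
  have hj : K ≤ n / K := (Nat.le_div_iff_mul_le hK).mpr hn
  have hs : n % K < K := Nat.mod_lt _ hK
  -- With n = qK + s and q ≥ K, the image f^(qK)(G) contains f^(K-s)(G); applying s more steps
  -- reaches f^K(G) ⊇ G.
  have h2 := hmix (n / K) (K - n % K) (by omega)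
  have h3 : G ⊆ f^[n % K] '' (f^[K - n % K] '' G) := by
    rw [← image_comp, ← Function.iterate_add, Nat.add_sub_cancel' hs.le]
    exact h₀
  have h4 : n = n % K + n / K * K := by
    rw [mul_comm]; exact (Nat.mod_add_div n K).symm
  calc G ⊆ f^[n % K] '' (f^[K - n % K] '' G) := h3
    _ ⊆ f^[n % K] '' (f^[n / K * K] '' G) := image_mono h2
    _ = f^[n % K + n / K * K] '' G := by rw [Function.iterate_add, image_comp]
    _ = f^[n] '' G := by rw [← h4]

/-! ### Measurability and Lebesgue measure of forward images -/

lemma measurable_negBetaReal (β : ℝ) : Measurable (negBetaReal β) := by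
  unfold negBetaReal
  have : Measurable fun x : ℝ => (⌊β * x⌋ : ℝ) :=
    measurable_from_top.comp (Int.measurable_floor.comp (measurable_const_mul β))
  exact ((measurable_const_mul (-β)).add this).add_const 1

/-- The set on which `⌊β x⌋ = d`. -/
def negBetaBranch (β : ℝ) (d : ℤ) : Set ℝ := {x | ⌊β * x⌋ = d}

lemma measurableSet_negBetaBranch (β : ℝ) (d : ℤ) : MeasurableSet (negBetaBranch β d) :=
  (Int.measurable_floor.comp (measurable_const_mul β)) (measurableSet_singleton d)

lemma iUnion_inter_negBetaBranch (β : ℝ) (E : Set ℝ) : ⋃ d, E ∩ negBetaBranch β d = E := by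
  ext x
  simp [negBetaBranch]

lemma negBetaReal_image_branch (β : ℝ) (E : Set ℝ) (d : ℤ) :
    negBetaReal β '' (E ∩ negBetaBranch β d) =
      (fun x => x + ((d : ℝ) + 1)) '' ((fun x => -β * x) '' (E ∩ negBetaBranch β d)) := by
  rw [← image_comp]
  refine image_congr fun x hx => ?_
  have : ⌊β * x⌋ = d := hx.2
  simp only [negBetaReal, this, Function.comp_apply]
  ring

open scoped Pointwise in
lemma volume_image_branch {β : ℝ} (hβ : 0 < β) (E : Set ℝ) (d : ℤ) :
    volume (negBetaReal β '' (E ∩ negBetaBranch β d)) =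
      ENNReal.ofReal β * volume (E ∩ negBetaBranch β d) := by
  rw [negBetaReal_image_branch, image_add_right, measure_preimage_add_right]
  have : (fun x => -β * x) '' (E ∩ negBetaBranch β d) = (-β) • (E ∩ negBetaBranch β d) := rfl
  rw [this, Measure.addHaar_smul]
  simp [abs_of_pos hβ]

lemma measurableSet_image_negBetaReal {β : ℝ} (hβ : 0 < β) {E : Set ℝ} (hE : MeasurableSet E) :
    MeasurableSet (negBetaReal β '' E) := by
  rw [← iUnion_inter_negBetaBranch β E, image_iUnion]
  refine MeasurableSet.iUnion fun d => ?_
  refine (hE.inter (measurableSet_negBetaBranch β d)).image_of_measurable_injOn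
    (measurable_negBetaReal β) fun x hx y hy hxy => ?_
  have h1 : ⌊β * x⌋ = d := hx.2
  have h2 : ⌊β * y⌋ = d := hy.2
  simp only [negBetaReal, h1, h2] at hxy
  exact mul_left_cancel₀ hβ.ne' (by linarith)

lemma measurableSet_image_iterate_negBetaReal {β : ℝ} (hβ : 0 < β) {E : Set ℝ}
    (hE : MeasurableSet E) (n : ℕ) : MeasurableSet ((negBetaReal β)^[n] '' E) := by
  induction n with
  | zero => simpa using hE
  | succ n ih =>
    rw [Function.iterate_succ', image_comp]
    exact measurableSet_image_negBetaReal hβ ih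

/-- Each branch scales measure by exactly β, and overlaps between branch images only lose measure.
The measurable hull covers arbitrary E. -/
lemma volume_image_negBetaReal_le {β : ℝ} (hβ : 0 < β) (E : Set ℝ) :
    volume (negBetaReal β '' E) ≤ ENNReal.ofReal β * volume E := by
  set E' := toMeasurable volume E
  have hE' : MeasurableSet E' := measurableSet_toMeasurable _ _
  calc volume (negBetaReal β '' E) ≤ volume (negBetaReal β '' E') :=
        measure_mono (image_mono (subset_toMeasurable _ _))
    _ = volume (⋃ d, negBetaReal β '' (E' ∩ negBetaBranch β d)) := by
        rw [← image_iUnion, iUnion_inter_negBetaBranch]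
    _ ≤ ∑' d, volume (negBetaReal β '' (E' ∩ negBetaBranch β d)) := measure_iUnion_le _
    _ = ENNReal.ofReal β * ∑' d, volume (E' ∩ negBetaBranch β d) := by
        simp_rw [volume_image_branch hβ]
        rw [ENNReal.tsum_mul_left]
    _ = ENNReal.ofReal β * volume E' := by
        rw [← measure_iUnion, iUnion_inter_negBetaBranch]
        · intro d e hde
          refine disjoint_left.mpr fun x hx hy => hde ?_
          exact (show ⌊β * x⌋ = d from hx.2).symm.trans hy.2
        · exact fun d => hE'.inter (measurableSet_negBetaBranch β d)
    _ = ENNReal.ofReal β * volume E := by rw [measure_toMeasurable]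

lemma volume_image_iterate_negBetaReal_le {β : ℝ} (hβ : 0 < β) (E : Set ℝ) (n : ℕ) :
    volume ((negBetaReal β)^[n] '' E) ≤ ENNReal.ofReal (β ^ n) * volume E := by
  induction n with
  | zero => simp
  | succ n ih =>
    rw [Function.iterate_succ', image_comp, pow_succ', ENNReal.ofReal_mul hβ.le, mul_assoc]
    exact (volume_image_negBetaReal_le hβ _).trans (by gcongr)

/-- A point of G missed by f^(m+n)(A) is the f^m-image of a point of J missed by f^n(A). This moves
lower bounds on the missed part backwards and upper bounds forwards. -/
lemma volume_diff_image_le {β : ℝ} (hβ : 0 < β) {G J A : Set ℝ} {m n : ℕ}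
    (hG : G ⊆ (negBetaReal β)^[m] '' J) :
    volume (G \ (negBetaReal β)^[m + n] '' A) ≤
      ENNReal.ofReal (β ^ m) * volume (J \ (negBetaReal β)^[n] '' A) := by
  refine le_trans (measure_mono ?_) (volume_image_iterate_negBetaReal_le hβ _ m)
  rw [Function.iterate_add, image_comp]
  rintro y ⟨hy, hyA⟩
  obtain ⟨x, hx, rfl⟩ := hG hy
  exact ⟨x, ⟨hx, fun h => hyA ⟨x, h, rfl⟩⟩, rfl⟩

/-! ### Sets of positive measure nearly fill a fixed interval -/

/-- If all forward images of `A` miss a proportion `η` of every long interval, then `A` misses a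
proportion `η` of every interval, up to an error that decays with the number of steps. -/
lemma volume_diff_lower_bound {β : ℝ} {k : ℕ} {δ η : ℝ} (hk : 2 < β ^ k) (hβ : 1 < β)
    (hδ : 0 < δ) (hη : 0 < η)
    (hsplit : ∀ a b, a < b → Ioo a b ⊆ Ioo 0 1 → b - a < δ →
      ∃ m ∈ Icc a b, (∃ c, ∀ x ∈ Ioo a m, (negBetaReal β)^[k] x = (-β) ^ k * x + c) ∧
        ∃ c, ∀ x ∈ Ioo m b, (negBetaReal β)^[k] x = (-β) ^ k * x + c) (j : ℕ) :
    ∀ A : Set ℝ, (∀ n a b, δ ≤ b - a → Ioo a b ⊆ Ioo 0 1 →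
        ENNReal.ofReal (η * (b - a)) ≤ volume (Ioo a b \ (negBetaReal β)^[n] '' A)) →
      ∀ a b, a ≤ b → Ioo a b ⊆ Ioo 0 1 →
        ENNReal.ofReal (η * ((b - a) - δ * (2 / β ^ k) ^ j)) ≤ volume (Ioo a b \ A) := by
  have hβ0 : 0 < β := by linarith
  have hB : 0 < β ^ k := by linarith
  have hs : (-β) ^ k ≠ 0 := pow_ne_zero _ (neg_ne_zero.mpr hβ0.ne')
  have habs : |(-β) ^ k| = β ^ k := by rw [abs_pow, abs_neg, abs_of_pos hβ0]
  have hlong : ∀ (j : ℕ) (A : Set ℝ), (∀ n a b, δ ≤ b - a → Ioo a b ⊆ Ioo 0 1 →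
        ENNReal.ofReal (η * (b - a)) ≤ volume (Ioo a b \ (negBetaReal β)^[n] '' A)) →
      ∀ a b, δ ≤ b - a → Ioo a b ⊆ Ioo 0 1 →
        ENNReal.ofReal (η * ((b - a) - δ * (2 / β ^ k) ^ j)) ≤ volume (Ioo a b \ A) := by
    intro j A hA a b hlen h01
    refine le_trans (ENNReal.ofReal_le_ofReal ?_) (by simpa using hA 0 a b hlen h01)
    have : 0 ≤ δ * (2 / β ^ k) ^ j := by positivity
    exact mul_le_mul_of_nonneg_left (by linarith) hη.le
  induction j with
  | zero =>
    intro A hA a b hab h01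
    rcases le_or_gt δ (b - a) with hlen | hlen
    · exact hlong 0 A hA a b hlen h01
    · rw [ENNReal.ofReal_of_nonpos]
      · exact zero_le
      · exact mul_nonpos_of_nonneg_of_nonpos hη.le (by simp; linarith)
  | succ j ih =>
    intro A hA a b hab h01
    rcases le_or_gt δ (b - a) with hlen | hlen
    · exact hlong (j + 1) A hA a b hlen h01
    rcases hab.eq_or_lt with rfl | hab
    · rw [ENNReal.ofReal_of_nonpos]
      · exact zero_le
      · have : 0 ≤ δ * (2 / β ^ k) ^ (j + 1) := by positivity
        exact mul_nonpos_of_nonneg_of_nonpos hη.le (by linarith)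
    obtain ⟨m, hm, hl, hr⟩ := hsplit a b hab h01 hlen
    have hA' : ∀ n a b, δ ≤ b - a → Ioo a b ⊆ Ioo 0 1 → ENNReal.ofReal (η * (b - a)) ≤
        volume (Ioo a b \ (negBetaReal β)^[n] '' ((negBetaReal β)^[k] '' A)) := by
      intro n a b h1 h2
      rw [← image_comp, ← Function.iterate_add]
      exact hA _ a b h1 h2
    have piece : ∀ p q, p ≤ q → Ioo p q ⊆ Ioo 0 1 →
        (∃ c, ∀ x ∈ Ioo p q, (negBetaReal β)^[k] x = (-β) ^ k * x + c) →
        ENNReal.ofReal (η * ((q - p) - δ * (2 / β ^ k) ^ j / β ^ k)) ≤ volume (Ioo p q \ A) := by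
      rintro p q hpq hpq01 ⟨c, hc⟩
      obtain ⟨p', q', him, hlen'⟩ := exists_image_Ioo_of_affine hs hc
      rw [habs] at hlen'
      have h1 := ih _ hA' p' q' (by nlinarith) (Ioo_subset_Ioo_of_subset_Ioc (by
        rw [← him]
        exact image_iterate_subset_Ioc (hpq01.trans Ioo_subset_Ioc_self) k))
      have h2 := h1.trans (volume_diff_image_le (n := 0) (A := A) hβ0 him.ge)
      simp only [Function.iterate_zero, image_id] at h2
      have h3 : η * ((q' - p') - δ * (2 / β ^ k) ^ j) =
          β ^ k * (η * ((q - p) - δ * (2 / β ^ k) ^ j / β ^ k)) := by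
        rw [hlen']; field_simp
      rw [h3, ENNReal.ofReal_mul hB.le] at h2
      exact (ENNReal.mul_le_mul_iff_right (by simpa using hB) ENNReal.ofReal_ne_top).mp h2
    have hll : Ioo a m ⊆ Ioo a b := Ioo_subset_Ioo_right hm.2
    have hrr : Ioo m b ⊆ Ioo a b := Ioo_subset_Ioo_left hm.1
    have hL := piece a m hm.1 (hll.trans h01) hl
    have hR := piece m b hm.2 (hrr.trans h01) hr
    -- Each of the two pieces inherits the old error divided by β ^ k, so the total error is
    -- multiplied by 2 / β ^ k < 1.
    calc ENNReal.ofReal (η * ((b - a) - δ * (2 / β ^ k) ^ (j + 1)))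
        = ENNReal.ofReal (η * ((m - a) - δ * (2 / β ^ k) ^ j / β ^ k) +
            η * ((b - m) - δ * (2 / β ^ k) ^ j / β ^ k)) := by congr 1; ring
      _ ≤ volume (Ioo a m \ A) + volume (Ioo m b \ A) :=
          ENNReal.ofReal_add_le.trans (add_le_add hL hR)
      _ ≤ volume ((Ioo a b \ A) ∩ Ioo a m) + volume ((Ioo a b \ A) \ Ioo a m) :=
          add_le_add (measure_mono fun x hx => ⟨⟨hll hx.1, hx.2⟩, hx.1⟩)
            (measure_mono fun x hx => ⟨⟨hrr hx.1, hx.2⟩, fun h => lt_asymm h.2 hx.1.1⟩)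
      _ = volume (Ioo a b \ A) := measure_inter_add_sdiff _ measurableSet_Ioo

/-- A set of positive measure nearly fills some small interval. -/
lemma exists_interval_nearly_filled {A : Set ℝ} (hA : MeasurableSet A) (h01 : A ⊆ Ioc 0 1)
    (hpos : 0 < volume A) {η : ℝ} (hη : 0 < η) :
    ∃ a b, a < b ∧ Ioo a b ⊆ Ioo 0 1 ∧ volume (Ioo a b \ A) < ENNReal.ofReal (η * (b - a)) := by
  have hae := Besicovitch.ae_tendsto_measure_inter_div (volume : Measure ℝ) A
  -- Discarding the endpoint 1 leaves room for a two-sided interval around the density point.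
  have hne : ∀ᵐ x ∂(volume.restrict A), x ≠ 1 :=
    ae_restrict_of_ae (by simp [ae_iff, measure_singleton])
  have : NeZero (volume.restrict A) := ⟨by rw [Ne, Measure.restrict_eq_zero]; exact hpos.ne'⟩
  obtain ⟨x, hx, hx1, hxA⟩ := ((hae.and (hne.and (ae_restrict_mem hA)))).exists
  have hx01 : 0 < x ∧ x < 1 := ⟨(h01 hxA).1, lt_of_le_of_ne (h01 hxA).2 hx1⟩
  set θ : ENNReal := 1 - ENNReal.ofReal (min (η) 1 / 2) with hθ
  have hθ1 : θ < 1 := ENNReal.sub_lt_self ENNReal.one_ne_top one_ne_zero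
    (by simp [hη])
  have ev := hx.eventually (lt_mem_nhds hθ1)
  have ev2 : ∀ᶠ r in 𝓝[>] (0 : ℝ), r < min x (1 - x) :=
    nhdsWithin_le_nhds (gt_mem_nhds (lt_min hx01.1 (by linarith)))
  obtain ⟨r, hr, hr2, hr0⟩ := (ev.and (ev2.and self_mem_nhdsWithin)).exists
  replace hr0 : 0 < r := hr0
  rw [lt_min_iff] at hr2
  refine ⟨x - r, x + r, by linarith, Ioo_subset_Ioo (by linarith) (by linarith), ?_⟩
  have hIcc : volume (Ioo (x - r) (x + r) \ A) ≤ volume (Metric.closedBall x r \ A) := by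
    rw [Real.closedBall_eq_Icc]
    exact measure_mono (sdiff_subset_sdiff_left Ioo_subset_Icc_self)
  have hvol : volume (Metric.closedBall x r) = ENNReal.ofReal (2 * r) := Real.volume_closedBall x r
  have hadd := measure_inter_add_sdiff (μ := volume) (Metric.closedBall x r) hA
  rw [inter_comm] at hadd
  rw [hvol] at hr hadd
  have hr' : ENNReal.ofReal (2 * r) ≠ 0 := by simpa using hr0
  rw [ENNReal.lt_div_iff_mul_lt (Or.inl hr') (Or.inl ENNReal.ofReal_ne_top)] at hr
  refine hIcc.trans_lt ?_
  have hfin : volume (A ∩ Metric.closedBall x r) ≠ ⊤ :=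
    ne_top_of_le_ne_top (b := ENNReal.ofReal (2 * r)) ENNReal.ofReal_ne_top (hadd ▸ le_self_add)
  have hfin2 : volume (Metric.closedBall x r \ A) ≠ ⊤ :=
    ne_top_of_le_ne_top (b := ENNReal.ofReal (2 * r)) ENNReal.ofReal_ne_top (hadd ▸ le_add_self)
  have hmin : 0 < min η 1 := lt_min hη one_pos
  have hθr : θ = ENNReal.ofReal (1 - min η 1 / 2) := by
    rw [hθ, ← ENNReal.ofReal_one, ENNReal.ofReal_sub _ (by positivity)]
  rw [hθr, ← ENNReal.ofReal_mul (by linarith [min_le_right η 1]), ← ENNReal.ofReal_toReal hfin,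
    ENNReal.ofReal_lt_ofReal_iff_of_nonneg
      (mul_nonneg (by linarith [min_le_right η 1]) (by linarith))] at hr
  rw [← ENNReal.ofReal_toReal hfin, ← ENNReal.ofReal_toReal hfin2,
    ← ENNReal.ofReal_add ENNReal.toReal_nonneg ENNReal.toReal_nonneg,
    ENNReal.ofReal_eq_ofReal_iff (by positivity) (by linarith)] at hadd
  rw [← ENNReal.ofReal_toReal hfin2, ENNReal.ofReal_lt_ofReal_iff_of_nonneg ENNReal.toReal_nonneg]
  nlinarith [min_le_left η 1]

/-- A fixed interval `G` at `0` which is eventually covered by its own iterates, and which is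
nearly filled by some iterate of every set of positive Lebesgue measure. -/
lemma exists_attracting_interval {β : ℝ} (hβ : 1 < β) :
    ∃ ε, 0 < ε ∧ ε ≤ 1 ∧ (∃ N : ℕ, ∀ n ≥ N, Ioo 0 ε ⊆ (negBetaReal β)^[n] '' Ioo 0 ε) ∧
      ∀ A : Set ℝ, MeasurableSet A → A ⊆ Ioc 0 1 → 0 < volume A → ∀ η > (0 : ℝ),
        ∃ n : ℕ, volume (Ioo 0 ε \ (negBetaReal β)^[n] '' A) < ENNReal.ofReal η := by
  have hβ0 : 0 < β := by linarith
  obtain ⟨k, δ, hδ, hk, hsplit⟩ := exists_iterate_two_branches hβ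
  obtain ⟨ε, h0, h1, M, hM⟩ := exists_uniform_endpoint_interval hβ hδ
  have hcover : ∀ a b, a < b → Ioo a b ⊆ Ioo 0 1 →
      ∃ n : ℕ, Ioo 0 ε ⊆ (negBetaReal β)^[n] '' Ioo a b := by
    intro a b hab h01
    obtain ⟨n, a', b', hlen, hsub⟩ := exists_iterate_image_long hk hβ hsplit hab h01
    obtain ⟨m, -, hm⟩ := hM a' b' hlen (Ioo_subset_Ioo_of_subset_Ioc
      (hsub.trans (image_iterate_subset_Ioc (h01.trans Ioo_subset_Ioc_self) n)))
    exact ⟨m + n, image_iterate_add_subset hsub hm⟩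
  have hG : Ioo 0 ε ⊆ Ioo 0 1 := Ioo_subset_Ioo_right h1
  refine ⟨ε, h0, h1, ?_, ?_⟩
  · obtain ⟨k', ε', h0', h1', hsub⟩ := exists_iterate_image_endpoints hβ h0 hG
    have hε' : ε' / β ≤ ε' := div_le_self h0'.le hβ.le
    obtain ⟨n, hn⟩ := hcover 0 (ε' / β) (by positivity)
      (Ioo_subset_Ioo_right (hε'.trans h1'))
    -- Let I = (0, ε'/β), so fⁿ(I) ⊇ G. The iterate k' + 1 of G contains I, and also (1 - ε', 1) ⊇
    -- f(I); n further steps cover both G and f(G) at the same time, which rules out periodicity.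
    refine ⟨_, subset_iterate_image_of_consecutive (K := n + (k' + 1)) (by omega) ?_ ?_⟩
    · exact image_iterate_add_subset
        ((Ioo_subset_Ioo_right hε').trans (subset_union_left.trans hsub)) hn
    · refine image_iterate_add_subset
        ((image_Ioo_zero hβ0 h1').trans (subset_union_right.trans hsub)) ?_
      rw [← image_comp, ← Function.iterate_succ, Function.iterate_succ', image_comp]
      exact image_mono hn
  · intro A hA hA01 hpos η hη
    by_contra! hcon
    -- Every long interval reaches G in at most M steps, each expanding measure by at most β, so a
    -- loss η in G comes from a loss of at least η / β ^ M in the interval.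
    have hη' : 0 < η / β ^ M := by positivity
    obtain ⟨a, b, hab, h01, hlt⟩ := exists_interval_nearly_filled hA hA01 hpos hη'
    have hlow : ∀ n a b, δ ≤ b - a → Ioo a b ⊆ Ioo 0 1 →
        ENNReal.ofReal (η / β ^ M * (b - a)) ≤ volume (Ioo a b \ (negBetaReal β)^[n] '' A) := by
      intro n a b hlen h01
      obtain ⟨m, hmM, hm⟩ := hM a b hlen h01
      have h2 := (hcon (m + n)).trans (volume_diff_image_le hβ0 hm)
      have hle : b - a ≤ 1 := sub_le_one_of_Ioo_subset (h01.trans Ioo_subset_Ioc_self)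
      have hβm : ENNReal.ofReal (β ^ m) ≠ 0 := by simpa using pow_pos hβ0 m
      refine (ENNReal.mul_le_mul_iff_right hβm ENNReal.ofReal_ne_top).mp (le_trans ?_ h2)
      rw [← ENNReal.ofReal_mul (by positivity)]
      refine ENNReal.ofReal_le_ofReal ?_
      have hpw : β ^ m ≤ β ^ M := pow_le_pow_right₀ hβ.le hmM
      calc β ^ m * (η / β ^ M * (b - a)) ≤ β ^ M * (η / β ^ M * 1) :=
            mul_le_mul hpw (mul_le_mul_of_nonneg_left hle hη'.le)
              (mul_nonneg hη'.le (by linarith)) (by positivity)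
        _ = η := by field_simp
    have hall := fun j => volume_diff_lower_bound hk hβ hδ hη' hsplit j A hlow a b hab.le h01
    have hlim : Tendsto (fun j : ℕ => ENNReal.ofReal
        (η / β ^ M * ((b - a) - δ * (2 / β ^ k) ^ j))) atTop
        (𝓝 (ENNReal.ofReal (η / β ^ M * ((b - a) - δ * 0)))) := by
      refine ENNReal.tendsto_ofReal (Tendsto.const_mul _ (tendsto_const_nhds.sub
        (Tendsto.const_mul _ (tendsto_pow_atTop_nhds_zero_of_lt_one (by positivity) ?_))))
      rw [div_lt_one (by linarith)]; exact hk
    rw [mul_zero, sub_zero] at hlim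
    exact absurd (le_of_tendsto' hlim hall) hlt.not_ge

/-! ### Absolutely continuous invariant measures: images exhaust the mass -/

lemma exists_pos_measure_lt_of_absolutelyContinuous {α : Type*} [MeasurableSpace α]
    {μ ν : Measure α} [SigmaFinite ν] [IsFiniteMeasure μ] (h : μ ≪ ν) {κ : ENNReal}
    (hκ : κ ≠ 0) : ∃ δ > 0, ∀ s, ν s < δ → μ s < κ := by
  obtain ⟨δ, h0, hδ⟩ := exists_pos_setLIntegral_lt_of_measure_lt
    (Measure.lintegral_rnDeriv_lt_top μ ν).ne hκ
  refine ⟨δ, h0, fun s hs => ?_⟩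
  have := hδ s hs
  rwa [Measure.setLIntegral_rnDeriv h] at this

/-- E lies in f⁻¹(f(E)); the measurable hull is used because f(E) need not be measurable. -/
lemma MeasureTheory.MeasurePreserving.measure_le_measure_image {α : Type*} [MeasurableSpace α]
    {μ : Measure α} {f : α → α} (hf : MeasurePreserving f μ μ) (E : Set α) :
    μ E ≤ μ (f '' E) := by
  rw [← measure_toMeasurable (f '' E),
    ← hf.measure_preimage (measurableSet_toMeasurable μ (f '' E)).nullMeasurableSet]
  exact measure_mono ((subset_preimage_image f E).trans
    (preimage_mono (subset_toMeasurable _ _)))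

lemma MeasureTheory.MeasurePreserving.monotone_measure_iterate_image {α : Type*}
    [MeasurableSpace α] {μ : Measure α} {f : α → α} (hf : MeasurePreserving f μ μ) (E : Set α) :
    Monotone fun n : ℕ => μ (f^[n] '' E) := by
  refine monotone_nat_of_le_succ fun n => ?_
  rw [Function.iterate_succ', image_comp]
  exact hf.measure_le_measure_image _

/-- A forward invariant measurable set that is entered by almost every point has full measure. -/
lemma MeasureTheory.MeasurePreserving.measure_eq_of_forward_invariant {α : Type*}
    [MeasurableSpace α] {μ : Measure α} {f : α → α} (hf : MeasurePreserving f μ μ) {U : Set α}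
    (hU : MeasurableSet U) (hfU : U ⊆ f ⁻¹' U) (hent : ∀ᵐ x ∂μ, ∃ n : ℕ, f^[n] x ∈ U) :
    μ U = μ univ := by
  have hmono : Monotone fun n : ℕ => (f^[n]) ⁻¹' U := by
    refine monotone_nat_of_le_succ fun n => ?_
    rw [Function.iterate_succ', preimage_comp]
    exact preimage_mono hfU
  have h1 : μ (⋃ n : ℕ, (f^[n]) ⁻¹' U) = μ univ :=
    measure_congr (by
      rw [ae_eq_univ, ← mem_ae_iff]
      filter_upwards [hent] with x hx
      simpa using hx)
  rw [← h1, hmono.measure_iUnion]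
  simp [fun n => (hf.iterate n).measure_preimage hU.nullMeasurableSet]

/-- Iterates of a set of positive measure exhaust the mass of an absolutely continuous
invariant probability measure. -/
lemma exists_iterate_image_measure_gt {β : ℝ} (hβ : 1 < β) {μ : Measure ℝ}
    [IsProbabilityMeasure μ] (hac : μ ≪ volume) (hf : MeasurePreserving (negBetaReal β) μ μ)
    (hμ : ∀ᵐ x ∂μ, x ∈ Ioc (0 : ℝ) 1) {A : Set ℝ} (hA : MeasurableSet A) (hA01 : A ⊆ Ioc 0 1)
    (hpos : 0 < μ A) {c : ENNReal} (hc : c < 1) :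
    ∃ n : ℕ, c < μ ((negBetaReal β)^[n] '' A) := by
  have hβ0 : 0 < β := by linarith
  obtain ⟨ε, h0, h1, ⟨N, hN⟩, hfill⟩ := exists_attracting_interval hβ
  set f := negBetaReal β with hfdef
  set G := Ioo 0 ε with hGdef
  have hG01 : G ⊆ Ioc 0 1 := (Ioo_subset_Ioo_right h1).trans Ioo_subset_Ioc_self
  have hmeas : ∀ n : ℕ, MeasurableSet (f^[n] '' G) :=
    measurableSet_image_iterate_negBetaReal hβ0 measurableSet_Ioo
  set U := ⋃ n : ℕ, f^[n] '' G with hUdef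
  have hU : MeasurableSet U := MeasurableSet.iUnion hmeas
  have hfU : U ⊆ f ⁻¹' U := by
    intro x hx
    obtain ⟨n, y, hy, rfl⟩ := mem_iUnion.mp hx
    exact mem_iUnion.mpr ⟨n + 1, y, hy, Function.iterate_succ_apply' f n y⟩
  have hent : ∀ᵐ x ∂μ, ∃ n : ℕ, f^[n] x ∈ U := by
    -- Points that never enter U. All images of W avoid G, whereas positive volume would force one
    -- of them to meet G.
    set W := Ioc (0 : ℝ) 1 ∩ ⋂ n : ℕ, (f^[n]) ⁻¹' Uᶜ with hW
    have hWm : MeasurableSet W := measurableSet_Ioc.inter (MeasurableSet.iInter fun n =>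
      ((measurable_negBetaReal β).iterate n) hU.compl)
    have hW0 : volume W = 0 := by
      by_contra hne
      obtain ⟨n, hn⟩ := hfill W hWm inter_subset_left (pos_iff_ne_zero.mpr hne) ε h0
      refine hn.not_ge ?_
      rw [sdiff_eq_self_iff_disjoint.mpr, Real.volume_Ioo, sub_zero]
      rw [disjoint_left]
      rintro _ ⟨x, hx, rfl⟩ hxG
      exact mem_iInter.mp hx.2 n (mem_iUnion.mpr ⟨0, by simpa using hxG⟩)
    have hW1 : ∀ᵐ x ∂μ, x ∉ W := measure_eq_zero_iff_ae_notMem.mp (hac hW0)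
    filter_upwards [hμ, hW1] with x hx hxW
    by_contra! hcon
    exact hxW ⟨hx, mem_iInter.mpr hcon⟩
  have hμU : μ U = 1 := by
    rw [hf.measure_eq_of_forward_invariant hU hfU hent, measure_univ]
  obtain ⟨c', hcc', hc'⟩ := exists_between hc
  have hacc := tendsto_measure_iUnion_accumulate (μ := μ) (f := fun n : ℕ => f^[n] '' G)
  rw [← hUdef, hμU] at hacc
  obtain ⟨M, hM⟩ := (hacc.eventually (lt_mem_nhds hc')).exists
  -- G ⊆ fʳ(G) for r ≥ N lets the first M + 1 images of G be absorbed into a single one.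
  have hsub : Set.accumulate (fun n : ℕ => f^[n] '' G) M ⊆ f^[M + N] '' G := by
    intro x hx
    obtain ⟨m, hm, hx⟩ := Set.mem_accumulate.mp hx
    have : f^[m] '' G ⊆ f^[m + (M + N - m)] '' G :=
      image_iterate_add_subset (hN _ (by omega)) le_rfl
    rw [Nat.add_sub_cancel' (by omega)] at this
    exact this hx
  obtain ⟨δ, hδ0, hδ⟩ := exists_pos_measure_lt_of_absolutelyContinuous hac
    (tsub_pos_of_lt hcc').ne'
  obtain ⟨δ', hδ'0, hδ'⟩ : ∃ δ' > (0 : ℝ), ENNReal.ofReal δ' ≤ δ := by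
    obtain ⟨x, hx0, hx⟩ := ENNReal.lt_iff_exists_nnreal_btwn.mp hδ0
    exact ⟨x, by exact_mod_cast hx0, by simpa using hx.le⟩
  have hvol : 0 < volume A := pos_iff_ne_zero.mpr fun h => hpos.ne' (hac h)
  -- The remaining M + N steps can enlarge the unfilled part of G by the factor β ^ (M + N).
  obtain ⟨n, hn⟩ := hfill A hA hA01 hvol (δ' / β ^ (M + N)) (by positivity)
  refine ⟨M + N + n, ?_⟩
  have hsmall : volume (f^[M + N] '' G \ f^[M + N + n] '' A) < δ := by
    refine (volume_diff_image_le (n := n) (A := A) hβ0 (le_refl (f^[M + N] '' G))).trans_lt ?_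
    refine lt_of_lt_of_le (ENNReal.mul_lt_mul_right (by simpa using pow_pos hβ0 _)
      ENNReal.ofReal_ne_top hn) ?_
    rw [← ENNReal.ofReal_mul (by positivity), mul_div_cancel₀ _ (by positivity)]
    exact hδ'
  have hlt : c' < μ (f^[M + N + n] '' A) + (c' - c) :=
    calc c' < μ (f^[M + N] '' G) := hM.trans_le (measure_mono hsub)
      _ ≤ μ (f^[M + N + n] '' A) + μ (f^[M + N] '' G \ f^[M + N + n] '' A) :=
          (measure_mono (by rw [union_sdiff_self]; exact subset_union_right)).trans
            (measure_union_le _ _)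
      _ ≤ μ (f^[M + N + n] '' A) + (c' - c) := by gcongr; exact (hδ _ hsmall).le
  by_contra! hle
  refine hlt.not_ge ?_
  calc μ (f^[M + N + n] '' A) + (c' - c) ≤ c + (c' - c) := by gcongr
    _ = c' := add_tsub_cancel_of_le hcc'.le

/-! ### Return to (0, 1]: exactness, ergodicity and uniqueness -/

lemma coe_negBetaMap_iterate (β : ℝ) (n : ℕ) (x : Ioc (0 : ℝ) 1) :
    (((negBetaMap β)^[n] x : Ioc (0 : ℝ) 1) : ℝ) = (negBetaReal β)^[n] x :=
  (Function.Semiconj.iterate_right (f := Subtype.val) (ga := negBetaMap β)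
    (gb := negBetaReal β) (fun _ => rfl) n) x

lemma measurable_negBetaMap (β : ℝ) : Measurable (negBetaMap β) :=
  ((measurable_negBetaReal β).comp measurable_subtype_coe).subtype_mk

lemma measurableEmbedding_coe_Ioc : MeasurableEmbedding (Subtype.val : Ioc (0 : ℝ) 1 → ℝ) :=
  MeasurableEmbedding.subtype_coe measurableSet_Ioc

lemma exists_iterate_negBetaMap_image_measure_gt {β : ℝ} (hβ : 1 < β)
    {μ : Measure (Ioc (0 : ℝ) 1)} (h : IsACInvariantMeasure (negBetaMap β) lebesgueIoc μ)
    {A : Set (Ioc (0 : ℝ) 1)} (hA : MeasurableSet A) (hpos : 0 < μ A) {c : ENNReal}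
    (hc : c < 1) : ∃ n : ℕ, c < μ ((negBetaMap β)^[n] '' A) := by
  have he := measurableEmbedding_coe_Ioc
  have := h.isProbabilityMeasure
  set μ' := μ.map Subtype.val with hμ'
  have : IsProbabilityMeasure μ' := Measure.isProbabilityMeasure_map he.measurable.aemeasurable
  have hval : ∀ s : Set (Ioc (0 : ℝ) 1), μ' (Subtype.val '' s) = μ s := by
    intro s
    rw [hμ', he.map_apply, preimage_image_eq _ Subtype.val_injective]
  have hac : μ' ≪ volume := by
    refine Measure.AbsolutelyContinuous.mk fun s hs h0 => ?_
    rw [hμ', he.map_apply]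
    refine h.absolutelyContinuous ?_
    rw [lebesgueIoc, he.comap_apply]
    exact measure_mono_null (image_preimage_subset _ _) h0
  have hf : MeasurePreserving (negBetaReal β) μ' μ' := by
    refine ⟨measurable_negBetaReal β, ?_⟩
    rw [hμ', Measure.map_map (measurable_negBetaReal β) he.measurable]
    have : negBetaReal β ∘ Subtype.val = Subtype.val ∘ negBetaMap β := rfl
    rw [this, ← Measure.map_map he.measurable (measurable_negBetaMap β),
      h.measurePreserving.map_eq]
  have hIoc : ∀ᵐ x ∂μ', x ∈ Ioc (0 : ℝ) 1 := by
    rw [hμ', he.ae_map_iff]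
    exact Eventually.of_forall fun x => x.2
  obtain ⟨n, hn⟩ := exists_iterate_image_measure_gt hβ hac hf hIoc (A := Subtype.val '' A)
    (he.measurableSet_image.mpr hA) (by rintro _ ⟨x, -, rfl⟩; exact x.2) (by rwa [hval]) hc
  refine ⟨n, ?_⟩
  have hcomp : Subtype.val ∘ (negBetaMap β)^[n] = (negBetaReal β)^[n] ∘ Subtype.val :=
    funext (coe_negBetaMap_iterate β n)
  rwa [← hval, ← image_comp, hcomp, image_comp]

lemma isExactMap_negBetaMap {β : ℝ} (hβ : 1 < β) {μ : Measure (Ioc (0 : ℝ) 1)}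
    (h : IsACInvariantMeasure (negBetaMap β) lebesgueIoc μ) : IsExactMap (negBetaMap β) μ := by
  have := h.isProbabilityMeasure
  refine ⟨h.isProbabilityMeasure, h.measurePreserving, fun A hA hpos => ?_⟩
  have hA0 : MeasurableSet A := by simpa using hA 0
  refine tendsto_order.mpr ⟨fun c hc => ?_, fun c hc =>
    Eventually.of_forall fun n => prob_le_one.trans_lt hc⟩
  obtain ⟨n, hn⟩ := exists_iterate_negBetaMap_image_measure_gt hβ h hA0 hpos hc
  exact eventually_atTop.mpr ⟨n, fun m hm =>
    hn.trans_le (h.measurePreserving.monotone_measure_iterate_image A hm)⟩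

/-- An invariant set contains all its forward images, whose measures come arbitrarily close to 1
unless the set is null. -/
lemma ergodic_negBetaMap {β : ℝ} (hβ : 1 < β) {μ : Measure (Ioc (0 : ℝ) 1)}
    (h : IsACInvariantMeasure (negBetaMap β) lebesgueIoc μ) : Ergodic (negBetaMap β) μ := by
  have := h.isProbabilityMeasure
  refine ⟨h.measurePreserving, ⟨fun s hs hinv => ?_⟩⟩
  rw [Filter.eventuallyConst_set']
  by_cases h0 : μ s = 0
  · exact Or.inl (ae_eq_empty.mpr h0)
  · refine Or.inr (ae_eq_univ.mpr ?_)
    rw [prob_compl_eq_zero_iff hs]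
    refine le_antisymm prob_le_one (le_of_forall_lt fun c hc => ?_)
    obtain ⟨n, hn⟩ := exists_iterate_negBetaMap_image_measure_gt hβ h hs
      (pos_iff_ne_zero.mpr h0) hc
    refine hn.trans_le (measure_mono ?_)
    have hmap : MapsTo (negBetaMap β) s s := fun x hx => by rwa [← hinv] at hx
    exact (hmap.iterate n).image_subset

/-- The average of μ and ν is again of this kind, hence ergodic. It dominates both, and an ergodic
probability equals every invariant probability absolutely continuous with respect to it. -/
lemma eq_of_isACInvariantMeasure {β : ℝ} (hβ : 1 < β) {μ ν : Measure (Ioc (0 : ℝ) 1)}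
    (hμ : IsACInvariantMeasure (negBetaMap β) lebesgueIoc μ)
    (hν : IsACInvariantMeasure (negBetaMap β) lebesgueIoc ν) : ν = μ := by
  have := hμ.isProbabilityMeasure
  have := hν.isProbabilityMeasure
  set ρ : Measure (Ioc (0 : ℝ) 1) := (2⁻¹ : ENNReal) • (μ + ν) with hρ
  have h2 : (2⁻¹ : ENNReal) ≠ 0 := by simp
  have hρac : IsACInvariantMeasure (negBetaMap β) lebesgueIoc ρ := by
    refine ⟨⟨?_⟩, ?_, ⟨measurable_negBetaMap β, ?_⟩⟩
    · rw [hρ, Measure.smul_apply, Measure.add_apply, measure_univ, measure_univ, smul_eq_mul,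
        one_add_one_eq_two]
      exact ENNReal.inv_mul_cancel two_ne_zero ENNReal.ofNat_ne_top
    · exact (Measure.AbsolutelyContinuous.add_left hμ.absolutelyContinuous
        hν.absolutelyContinuous).smul_left _
    · rw [hρ, Measure.map_smul, Measure.map_add _ _ (measurable_negBetaMap β),
        hμ.measurePreserving.map_eq, hν.measurePreserving.map_eq]
  have := hρac.isProbabilityMeasure
  have herg := ergodic_negBetaMap hβ hρac
  have hμρ : μ ≪ ρ := (Measure.AbsolutelyContinuous.rfl.add_right ν).trans
    (Measure.absolutelyContinuous_smul h2)
  have hνρ : ν ≪ ρ := by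
    rw [hρ, add_comm]
    exact (Measure.AbsolutelyContinuous.rfl.add_right μ).trans
      (Measure.absolutelyContinuous_smul h2)
  rw [herg.eq_of_absolutelyContinuous hμ.measurePreserving hμρ,
    herg.eq_of_absolutelyContinuous hν.measurePreserving hνρ]

/-! ### Existence: an invariant signed measure built on the orbit of 1 -/

/-- The positive part of an invariant difference of finite measures is invariant. -/
lemma exists_invariant_measure_of_not_le {α : Type*} [MeasurableSpace α] {f : α → α}
    (hf : Measurable f) {μ ν : Measure α} [IsFiniteMeasure μ] [IsFiniteMeasure ν]
    (hinv : ∀ S, MeasurableSet S → μ (f ⁻¹' S) + ν S = ν (f ⁻¹' S) + μ S) (hne : ¬ μ ≤ ν) :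
    ∃ τ : Measure α, τ ≤ μ ∧ τ ≠ 0 ∧ MeasurePreserving f τ τ := by
  obtain ⟨s, hs, hpos, hneg⟩ := hahn_decomposition μ ν
  have hle : ν.restrict s ≤ μ.restrict s := by
    refine Measure.le_iff.mpr fun t ht => ?_
    rw [Measure.restrict_apply ht, Measure.restrict_apply ht]
    exact hpos _ (ht.inter hs) inter_subset_right
  set τ := μ.restrict s - ν.restrict s with hτ
  have hadd : ∀ t, MeasurableSet t → τ t + ν (t ∩ s) = μ (t ∩ s) := by
    intro t ht
    have := congrArg (fun m => m t) (Measure.sub_add_cancel_of_le hle)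
    simpa [Measure.add_apply, Measure.restrict_apply ht] using this
  have hτμ : τ ≤ μ := Measure.sub_le.trans Measure.restrict_le_self
  have : IsFiniteMeasure τ := isFiniteMeasure_of_le μ hτμ
  have hge : ∀ t, MeasurableSet t → μ t ≤ τ t + ν t := by
    intro t ht
    rw [← measure_inter_add_sdiff t hs, ← measure_inter_add_sdiff (μ := ν) t hs, ← add_assoc,
      hadd t ht]
    exact add_le_add le_rfl (hneg _ (ht.diff hs) fun x hx => hx.2)
  -- On subsets of the Hahn set s, τ is μ - ν, and everywhere τ ≥ μ - ν; invariance of μ - ν then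
  -- gives τ ≤ f_*τ, and equal total masses force equality.
  have hmap : τ ≤ τ.map f := by
    refine Measure.le_iff.mpr fun S hS => ?_
    rw [Measure.map_apply hf hS]
    have hR : MeasurableSet (S ∩ s) := hS.inter hs
    have h1 := hinv _ hR
    rw [← hadd S hS, ← add_assoc] at h1
    have h2 := (ENNReal.add_left_inj (measure_ne_top ν _)).mp h1
    have h3 := hge _ (hf hR)
    rw [h2, add_comm] at h3
    exact ((ENNReal.add_le_add_iff_right (measure_ne_top ν _)).mp h3).trans
      (measure_mono (preimage_mono inter_subset_left))
  refine ⟨τ, hτμ, fun h0 => hne (Measure.le_iff.mpr fun t ht => ?_), hf, ?_⟩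
  · simpa [h0] using hge t ht
  · refine (Measure.eq_of_le_of_measure_univ_eq hmap ?_).symm
    rw [Measure.map_apply hf MeasurableSet.univ, preimage_univ]

/-- The map sends [d/β, b) bijectively and affinely onto (d + 1 - βb, 1]; the image is all of (0, 1]
when b = (d + 1)/β. -/
lemma volume_preimage_inter_branch {β : ℝ} (hβ : 0 < β) (S : Set ℝ) {d : ℤ} {b : ℝ}
    (hb : b ≤ (d + 1) / β) :
    volume (negBetaReal β ⁻¹' S ∩ Ico (d / β) b) =
      ENNReal.ofReal β⁻¹ * volume (S ∩ Ioc (d + 1 - β * b) 1) := by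
  have hbr : Ico (d / β) b ⊆ negBetaBranch β d := by
    rintro x ⟨h1, h2⟩
    have h3 := h2.trans_le hb
    rw [div_le_iff₀ hβ] at h1
    rw [lt_div_iff₀ hβ] at h3
    exact Int.floor_eq_iff.mpr ⟨by linarith, by linarith⟩
  have hE : (negBetaReal β ⁻¹' S ∩ Ico (d / β) b) ∩ negBetaBranch β d =
      negBetaReal β ⁻¹' S ∩ Ico (d / β) b :=
    inter_eq_left.mpr (inter_subset_right.trans hbr)
  have hI := volume_image_branch hβ (negBetaReal β ⁻¹' S ∩ Ico (d / β) b) d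
  rw [hE, inter_comm, image_inter_preimage, inter_comm] at hI
  have him : negBetaReal β '' Ico (d / β) b = Ioc (d + 1 - β * b) 1 := by
    have hform : ∀ x ∈ Ico (d / β) b, negBetaReal β x = -β * x + (d + 1) := by
      intro x hx
      have : ⌊β * x⌋ = d := hbr hx
      rw [negBetaReal, this, add_assoc]
    ext y
    constructor
    · rintro ⟨x, hx, rfl⟩
      rw [hform x hx]
      have h1 := hx.1
      rw [div_le_iff₀ hβ] at h1
      have h2 := mul_lt_mul_of_pos_left hx.2 hβ
      exact ⟨by linarith, by linarith⟩
    · rintro ⟨h1, h2⟩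
      have hx : (d + 1 - y) / β ∈ Ico (d / β) b := by
        refine ⟨by gcongr; linarith, ?_⟩
        rw [div_lt_iff₀ hβ]; linarith
      refine ⟨_, hx, ?_⟩
      rw [hform _ hx]
      field_simp
      ring
  rw [him, inter_comm (Ico _ _)] at hI
  rw [hI, ← mul_assoc, ← ENNReal.ofReal_mul (by positivity), inv_mul_cancel₀ hβ.ne',
    ENNReal.ofReal_one, one_mul]

lemma volume_inter_Ico_split (E : Set ℝ) {a b c : ℝ} (hab : a ≤ b) (hbc : b ≤ c) :
    volume (E ∩ Ico a c) = volume (E ∩ Ico a b) + volume (E ∩ Ico b c) := by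
  rw [← measure_inter_add_sdiff (E ∩ Ico a c) (measurableSet_Ico (a := a) (b := b))]
  congr 2 <;> ext x <;> simp only [mem_inter_iff, Set.mem_sdiff, mem_Ico]
  · constructor
    · rintro ⟨⟨h1, -⟩, h2⟩; exact ⟨h1, h2⟩
    · rintro ⟨h1, h2⟩; exact ⟨⟨h1, h2.1, h2.2.trans_le hbc⟩, h2⟩
  · constructor
    · rintro ⟨⟨h1, h2⟩, h3⟩
      exact ⟨h1, not_lt.mp fun h => h3 ⟨h2.1, h⟩, h2.2⟩
    · rintro ⟨h1, h2⟩
      exact ⟨⟨h1, hab.trans h2.1, h2.2⟩, fun h => h.2.not_ge h2.1⟩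

lemma volume_preimage_inter_Ico_nat {β : ℝ} (hβ : 0 < β) (S : Set ℝ) (n : ℕ) :
    volume (negBetaReal β ⁻¹' S ∩ Ico 0 (n / β)) =
      ENNReal.ofReal β⁻¹ * n * volume (S ∩ Ioc 0 1) := by
  induction n with
  | zero => simp
  | succ n ih =>
    have hb := volume_preimage_inter_branch hβ S (d := n) (b := ((n : ℝ) + 1) / β) le_rfl
    rw [mul_div_cancel₀ _ hβ.ne', Int.cast_natCast, sub_self] at hb
    push_cast
    rw [volume_inter_Ico_split _ (b := n / β) (by positivity) (by gcongr; simp), ih, hb]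
    ring

/-- The transfer identity: the image of Lebesgue measure on `(0, a]`, completed by a multiple of
Lebesgue measure on `(0, f(a)]`, is a multiple of Lebesgue measure on `(0, 1]`. -/
lemma volume_preimage_inter_Ioc_add {β : ℝ} (hβ : 0 < β) (S : Set ℝ) {a : ℝ} (ha : 0 ≤ a) :
    volume (negBetaReal β ⁻¹' S ∩ Ioc 0 a) +
        ENNReal.ofReal β⁻¹ * volume (S ∩ Ioc 0 (negBetaReal β a)) =
      ENNReal.ofReal β⁻¹ * (⌊β * a⌋₊ + 1) * volume (S ∩ Ioc 0 1) := by
  have hIco : ∀ (E : Set ℝ) (x y : ℝ), volume (E ∩ Ioc x y) = volume (E ∩ Ico x y) := fun E x y =>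
    measure_congr ((ae_eq_refl E).inter Ico_ae_eq_Ioc.symm)
  have h0 : 0 ≤ β * a := by positivity
  have hfl : ((⌊β * a⌋₊ : ℤ) : ℝ) = ⌊β * a⌋ := by rw [Int.natCast_floor_eq_floor h0]
  have hle : (⌊β * a⌋₊ : ℝ) ≤ β * a := Nat.floor_le h0
  have hlt : β * a < ⌊β * a⌋₊ + 1 := Nat.lt_floor_add_one _
  -- After ⌊βa⌋ full branches, the remaining partial branch covers (f(a), 1]; the added term
  -- supplies exactly the missing (0, f(a)].
  have hb := volume_preimage_inter_branch hβ S (d := ⌊β * a⌋₊) (b := a)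
    (by rw [le_div_iff₀ hβ]; push_cast; linarith)
  have hval : ((⌊β * a⌋₊ : ℤ) : ℝ) + 1 - β * a = negBetaReal β a := by
    rw [negBetaReal, hfl]; ring
  rw [hval, Int.cast_natCast] at hb
  have hmem := negBetaReal_mem_Ioc β a
  rw [hIco _ 0 a, volume_inter_Ico_split _ (b := ⌊β * a⌋₊ / β) (by positivity)
    (by rw [div_le_iff₀ hβ]; linarith), volume_preimage_inter_Ico_nat hβ, hb,
    hIco _ (negBetaReal β a) 1, hIco _ 0 (negBetaReal β a), hIco _ 0 1,
    volume_inter_Ico_split S hmem.1.le hmem.2]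
  ring

/-- The sum of the measures `β⁻ᵏ λ|(0, fᵏ(1)]` over all `k` of the parity of `i`. -/
noncomputable def orbitMeasure (β : ℝ) (i : ℕ) : Measure ℝ :=
  Measure.sum fun j : ℕ => ENNReal.ofReal (β⁻¹ ^ (2 * j + i)) •
    volume.restrict (Ioc 0 ((negBetaReal β)^[2 * j + i] 1))

lemma orbitMeasure_apply (β : ℝ) (i : ℕ) {S : Set ℝ} (hS : MeasurableSet S) :
    orbitMeasure β i S = ∑' j : ℕ, ENNReal.ofReal (β⁻¹ ^ (2 * j + i)) *
      volume (S ∩ Ioc 0 ((negBetaReal β)^[2 * j + i] 1)) := by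
  simp [orbitMeasure, Measure.sum_apply _ hS, Measure.restrict_apply hS]

lemma iterate_negBetaReal_one_mem (β : ℝ) (n : ℕ) : (negBetaReal β)^[n] 1 ∈ Ioc (0 : ℝ) 1 :=
  iterate_negBetaReal_mem_Ioc (by simp) n

lemma summable_inv_pow_two_mul_add {β : ℝ} (hβ : 1 < β) (i : ℕ) :
    Summable fun j : ℕ => β⁻¹ ^ (2 * j + i) := by
  have h1 : Summable fun k : ℕ => β⁻¹ ^ k :=
    summable_geometric_of_lt_one (by positivity) (inv_lt_one_of_one_lt₀ hβ)
  exact h1.comp_injective fun a b hab => by simpa using hab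

lemma isFiniteMeasure_orbitMeasure {β : ℝ} (hβ : 1 < β) (i : ℕ) :
    IsFiniteMeasure (orbitMeasure β i) := by
  refine ⟨?_⟩
  rw [orbitMeasure_apply β i MeasurableSet.univ]
  refine lt_of_le_of_lt (ENNReal.tsum_le_tsum fun j => ?_)
    (summable_inv_pow_two_mul_add hβ i).tsum_ofReal_lt_top
  have := (iterate_negBetaReal_one_mem β (2 * j + i)).2
  simpa using mul_le_mul_right (ENNReal.ofReal_le_one.mpr this) (ENNReal.ofReal (β⁻¹ ^ (2 * j + i)))

lemma orbitMeasure_absolutelyContinuous (β : ℝ) (i : ℕ) : orbitMeasure β i ≪ volume :=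
  Measure.absolutelyContinuous_sum_left fun _ =>
    Measure.restrict_le_self.absolutelyContinuous.smul_left _

lemma orbitMeasure_compl_Ioc (β : ℝ) (i : ℕ) : orbitMeasure β i (Ioc 0 1)ᶜ = 0 := by
  rw [orbitMeasure_apply β i measurableSet_Ioc.compl]
  refine ENNReal.tsum_eq_zero.mpr fun j => ?_
  have h := iterate_negBetaReal_one_mem β (2 * j + i)
  have : (Ioc (0 : ℝ) 1)ᶜ ∩ Ioc 0 ((negBetaReal β)^[2 * j + i] 1) = ∅ := by
    rw [← disjoint_iff_inter_eq_empty, disjoint_compl_left_iff_subset]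
    exact Ioc_subset_Ioc_right h.2
  simp [this]

lemma orbitMeasure_zero_apply (β : ℝ) {S : Set ℝ} (hS : MeasurableSet S) :
    orbitMeasure β 0 S = volume (S ∩ Ioc 0 1) + orbitMeasure β 2 S := by
  rw [orbitMeasure_apply β 0 hS, orbitMeasure_apply β 2 hS, tsum_eq_zero_add' ENNReal.summable]
  simp [mul_add]

/-- The transfer identity at a = fᵏ(1), weighted by β⁻ᵏ, involves the term k + 1; summing over k of
one parity links `orbitMeasure β i` to `orbitMeasure β (i + 1)`. -/
lemma orbitMeasure_preimage_add {β : ℝ} (hβ : 0 < β) (i : ℕ) : ∃ c : ENNReal,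
    ∀ S, MeasurableSet S → orbitMeasure β i (negBetaReal β ⁻¹' S) + orbitMeasure β (i + 1) S =
      c * volume (S ∩ Ioc 0 1) := by
  refine ⟨∑' j : ℕ, ENNReal.ofReal (β⁻¹ ^ (2 * j + i)) *
    (ENNReal.ofReal β⁻¹ * (⌊β * (negBetaReal β)^[2 * j + i] 1⌋₊ + 1)), fun S hS => ?_⟩
  rw [orbitMeasure_apply β i (measurable_negBetaReal β hS), orbitMeasure_apply β (i + 1) hS,
    ← ENNReal.tsum_add, ← ENNReal.tsum_mul_right]
  refine tsum_congr fun j => ?_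
  rw [mul_assoc, ← volume_preimage_inter_Ioc_add hβ S (iterate_negBetaReal_one_mem β _).1.le,
    mul_add, ← Function.iterate_succ_apply' (negBetaReal β) (2 * j + i) 1, ← mul_assoc, ← ENNReal.ofReal_mul (by positivity),
    ← pow_succ]
  rfl

/-- Invariance of the even part minus the odd part, written without subtraction. Both sides are
multiples of λ on (0, 1], and comparing total masses identifies the constants. -/
lemma orbitMeasure_balance {β : ℝ} (hβ : 1 < β) {S : Set ℝ} (hS : MeasurableSet S) :
    orbitMeasure β 0 (negBetaReal β ⁻¹' S) + orbitMeasure β 1 S =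
      orbitMeasure β 1 (negBetaReal β ⁻¹' S) + orbitMeasure β 0 S := by
  have hβ0 : 0 < β := by linarith
  obtain ⟨c, hc⟩ := orbitMeasure_preimage_add hβ0 0
  obtain ⟨c', hc'⟩ := orbitMeasure_preimage_add hβ0 1
  have h' : ∀ S, MeasurableSet S → orbitMeasure β 1 (negBetaReal β ⁻¹' S) + orbitMeasure β 0 S =
      (c' + 1) * volume (S ∩ Ioc 0 1) := by
    intro S hS
    rw [orbitMeasure_zero_apply β hS, add_left_comm, hc' S hS]
    ring
  have hcc : c = c' + 1 := by
    have h1 := hc univ MeasurableSet.univ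
    have h2 := h' univ MeasurableSet.univ
    rw [preimage_univ, zero_add] at h1
    rw [preimage_univ, add_comm, h1] at h2
    simpa using h2
  have := hc S hS
  rw [zero_add] at this
  rw [this, h' S hS, hcc]

lemma orbitMeasure_apply_Ioc {β : ℝ} (hβ : 1 < β) (i : ℕ) {x : ℝ} (hx : 0 ≤ x) :
    (orbitMeasure β i (Ioc x 1)).toReal =
      ∑' j : ℕ, β⁻¹ ^ (2 * j + i) * max ((negBetaReal β)^[2 * j + i] 1 - x) 0 := by
  rw [orbitMeasure_apply β i measurableSet_Ioc, ENNReal.tsum_toReal_eq]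
  · refine tsum_congr fun j => ?_
    have h := iterate_negBetaReal_one_mem β (2 * j + i)
    rw [Ioc_inter_Ioc, sup_eq_left.mpr hx, inf_eq_right.mpr h.2, Real.volume_Ioc,
      ENNReal.toReal_mul, ENNReal.toReal_ofReal (by positivity), ENNReal.toReal_ofReal']
  · intro j
    refine ENNReal.mul_ne_top ENNReal.ofReal_ne_top
      (ne_top_of_le_ne_top ?_ (measure_mono inter_subset_left))
    simp

/-- The alternating sum over the returns of the orbit of `1` to `1` does not vanish. -/
lemma tsum_return_ne_zero {β : ℝ} (hβ : 1 < β) :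
    ∑' k : ℕ, (-β⁻¹) ^ k * (if (negBetaReal β)^[k] 1 = 1 then 1 else 0) ≠ (0 : ℝ) := by
  by_cases h : ∃ p : ℕ, 0 < p ∧ (negBetaReal β)^[p] 1 = 1
  · classical
    have hp := Nat.find_spec h
    have hmin := fun m (hm : m < Nat.find h) => Nat.find_min h hm
    set p := Nat.find h
    set g : ℕ → ℝ := fun k => (-β⁻¹) ^ k * (if (negBetaReal β)^[k] 1 = 1 then 1 else 0) with hg
    have hsum : Summable g := by
      refine Summable.of_norm_bounded (g := fun k => β⁻¹ ^ k)
        (summable_geometric_of_lt_one (by positivity) (inv_lt_one_of_one_lt₀ hβ)) fun k => ?_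
      have : 0 ≤ β⁻¹ := by positivity
      simp only [hg, norm_mul, norm_pow, norm_neg, Real.norm_of_nonneg this]
      refine mul_le_of_le_one_right (by positivity) ?_
      split_ifs <;> simp
    intro h0
    have hshift := hsum.sum_add_tsum_nat_add p
    -- With p the least period of 1, the sum s satisfies s = 1 + (-β⁻¹) ^ p * s, so s = 0 is
    -- impossible.
    have htail : ∀ k, g (k + p) = (-β⁻¹) ^ p * g k := by
      intro k
      simp only [hg, Function.iterate_add_apply, hp.2, pow_add]
      ring
    have hhead : ∑ k ∈ Finset.range p, g k = 1 := by
      rw [Finset.sum_eq_single 0]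
      · simp [hg]
      · intro k hk hk0
        have : (negBetaReal β)^[k] 1 ≠ 1 := fun hk1 =>
          hmin k (Finset.mem_range.mp hk) ⟨Nat.pos_of_ne_zero hk0, hk1⟩
        simp [hg, this]
      · intro hk
        exact absurd (Finset.mem_range.mpr hp.1) hk
    simp_rw [htail] at hshift
    rw [hhead, tsum_mul_left, h0] at hshift
    simp at hshift
  · rw [tsum_eq_single 0]
    · simp
    · intro k hk
      rw [if_neg fun hk1 => h ⟨k, Nat.pos_of_ne_zero hk, hk1⟩, mul_zero]

/-- Equality would make the alternating masses of (x, 1] cancel for every x in (0, 1). Dividing by 1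
- x and letting x → 1 leaves only the k with fᵏ(1) = 1, contradicting `tsum_return_ne_zero`. -/
lemma orbitMeasure_zero_ne_one {β : ℝ} (hβ : 1 < β) : orbitMeasure β 0 ≠ orbitMeasure β 1 := by
  intro heq
  have hq0 : 0 ≤ β⁻¹ := by positivity
  have hq : Summable fun k : ℕ => β⁻¹ ^ k :=
    summable_geometric_of_lt_one hq0 (inv_lt_one_of_one_lt₀ hβ)
  set t : ℕ → ℝ := fun k => (negBetaReal β)^[k] 1 with ht
  have ht1 : ∀ k, t k ∈ Ioc (0 : ℝ) 1 := iterate_negBetaReal_one_mem β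
  have hbound : ∀ k, ∀ x ∈ Ioo (0 : ℝ) 1, max (t k - x) 0 ≤ 1 - x := fun k x hx =>
    max_le (by linarith [(ht1 k).2]) (by linarith [hx.2])
  have hzero : ∀ x ∈ Ioo (0 : ℝ) 1, ∑' k : ℕ, (-β⁻¹) ^ k * (max (t k - x) 0 / (1 - x)) = 0 := by
    intro x hx
    have h1x : 0 < 1 - x := by linarith [hx.2]
    have hsummable : Summable fun k => (-β⁻¹) ^ k * max (t k - x) 0 := by
      refine Summable.of_norm_bounded (g := fun k => β⁻¹ ^ k) hq fun k => ?_
      rw [norm_mul, norm_pow, norm_neg, Real.norm_of_nonneg hq0,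
        Real.norm_of_nonneg (le_max_right _ _)]
      exact mul_le_of_le_one_right (by positivity) (by linarith [hbound k x hx, hx.1])
    have he := congrArg (fun m : Measure ℝ => (m (Ioc x 1)).toReal) heq
    simp only [orbitMeasure_apply_Ioc hβ _ hx.1.le] at he
    have hsplit := tsum_even_add_odd (f := fun k => (-β⁻¹) ^ k * max (t k - x) 0)
      (hsummable.comp_injective (i := fun j => 2 * j) (mul_right_injective₀ two_ne_zero))
      (hsummable.comp_injective (i := fun j => 2 * j + 1)
        ((add_left_injective 1).comp (mul_right_injective₀ two_ne_zero)))
    have hodd : ∀ j : ℕ, (-β⁻¹) ^ (2 * j + 1) = -(β⁻¹ ^ (2 * j + 1)) := fun j =>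
      Odd.neg_pow ⟨j, rfl⟩ _
    have heven : ∀ j : ℕ, (-β⁻¹) ^ (2 * j) = β⁻¹ ^ (2 * j) := fun j =>
      Even.neg_pow ⟨j, by ring⟩ _
    simp only [hodd, heven, neg_mul, tsum_neg] at hsplit
    simp_rw [← mul_div_assoc]
    rw [tsum_div_const, ← hsplit]
    simp only [add_zero] at he
    rw [he, add_neg_cancel, zero_div]
  have hlim : Tendsto (fun x : ℝ => ∑' k : ℕ, (-β⁻¹) ^ k * (max (t k - x) 0 / (1 - x))) (𝓝[<] 1)
      (𝓝 (∑' k : ℕ, (-β⁻¹) ^ k * (if t k = 1 then 1 else 0))) := by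
    refine tendsto_tsum_of_dominated_convergence hq (fun k => ?_) ?_
    · refine Tendsto.const_mul _ (tendsto_const_nhds.congr' ?_)
      split_ifs with h
      · filter_upwards [self_mem_nhdsWithin] with x hx
        have : 0 < 1 - x := sub_pos.mpr hx
        rw [h, max_eq_left this.le, div_self this.ne']
      · have hlt : t k < 1 := lt_of_le_of_ne (ht1 k).2 h
        filter_upwards [nhdsWithin_le_nhds (lt_mem_nhds hlt)] with x hx
        rw [max_eq_right (by linarith), zero_div]
    · filter_upwards [Ioo_mem_nhdsLT (zero_lt_one' ℝ)] with x hx k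
      have : 0 < 1 - x := by linarith [hx.2]
      rw [norm_mul, norm_pow, norm_neg, Real.norm_of_nonneg hq0,
        Real.norm_of_nonneg (div_nonneg (le_max_right _ _) this.le)]
      exact mul_le_of_le_one_right (by positivity) (div_le_one_of_le₀ (hbound k x hx) this.le)
  refine tsum_return_ne_zero hβ (tendsto_nhds_unique hlim (tendsto_const_nhds.congr' ?_))
  filter_upwards [Ioo_mem_nhdsLT (zero_lt_one' ℝ)] with x hx
  exact (hzero x hx).symm

lemma exists_invariant_measure_real {β : ℝ} (hβ : 1 < β) :
    ∃ τ : Measure ℝ, IsFiniteMeasure τ ∧ τ ≪ volume ∧ τ (Ioc 0 1)ᶜ = 0 ∧ τ ≠ 0 ∧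
      MeasurePreserving (negBetaReal β) τ τ := by
  have h₀ := isFiniteMeasure_orbitMeasure hβ 0
  have h₁ := isFiniteMeasure_orbitMeasure hβ 1
  have key : ∃ i, ∃ τ : Measure ℝ, IsFiniteMeasure (orbitMeasure β i) ∧ τ ≤ orbitMeasure β i ∧
      τ ≠ 0 ∧ MeasurePreserving (negBetaReal β) τ τ := by
    -- The sign of the signed measure is not known, so the positive part is taken of whichever
    -- difference has a nonzero one.
    by_cases hle : orbitMeasure β 0 ≤ orbitMeasure β 1
    · have hne : ¬ orbitMeasure β 1 ≤ orbitMeasure β 0 := fun h =>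
        orbitMeasure_zero_ne_one hβ (le_antisymm hle h)
      obtain ⟨τ, h⟩ := exists_invariant_measure_of_not_le (measurable_negBetaReal β)
        (fun S hS => (orbitMeasure_balance hβ hS).symm) hne
      exact ⟨1, τ, h₁, h⟩
    · obtain ⟨τ, h⟩ := exists_invariant_measure_of_not_le (measurable_negBetaReal β)
        (fun S hS => orbitMeasure_balance hβ hS) hle
      exact ⟨0, τ, h₀, h⟩
  obtain ⟨i, τ, hfin, hle, hne, hinv⟩ := key
  exact ⟨τ, isFiniteMeasure_of_le _ hle,
    hle.absolutelyContinuous.trans (orbitMeasure_absolutelyContinuous β i),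
    le_antisymm ((hle _).trans (orbitMeasure_compl_Ioc β i).le) zero_le, hne, hinv⟩

lemma exists_isACInvariantMeasure {β : ℝ} (hβ : 1 < β) :
    ∃ μ, IsACInvariantMeasure (negBetaMap β) lebesgueIoc μ := by
  obtain ⟨τ, hfin, hac, hcompl, hne, hinv⟩ := exists_invariant_measure_real hβ
  have he := measurableEmbedding_coe_Ioc
  set ρ : Measure (Ioc (0 : ℝ) 1) := τ.comap Subtype.val with hρ
  have hpre : ∀ E : Set ℝ, τ (E ∩ Ioc 0 1) = τ E := fun E =>
    measure_inter_conull hcompl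
  have huniv : ρ univ = τ univ := by
    rw [hρ, he.comap_apply, image_univ, Subtype.range_coe, ← hpre univ, univ_inter]
  have hρfin : IsFiniteMeasure ρ := ⟨by rw [huniv]; exact measure_lt_top τ univ⟩
  have hρne : NeZero ρ := ⟨fun h => hne (Measure.measure_univ_eq_zero.mp (by
    rw [← huniv, h, Measure.coe_zero, Pi.zero_apply]))⟩
  have hρmap : ρ.map (negBetaMap β) = ρ := by
    ext S hS
    rw [Measure.map_apply (measurable_negBetaMap β) hS, hρ, he.comap_apply, he.comap_apply]
    have himage : Subtype.val '' (negBetaMap β ⁻¹' S) =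
        negBetaReal β ⁻¹' (Subtype.val '' S) ∩ Ioc 0 1 := by
      ext x
      constructor
      · rintro ⟨y, hy, rfl⟩
        exact ⟨⟨_, hy, rfl⟩, y.2⟩
      · rintro ⟨⟨y, hy, hyx⟩, hx⟩
        refine ⟨⟨x, hx⟩, ?_, rfl⟩
        have : negBetaMap β ⟨x, hx⟩ = y := Subtype.ext hyx.symm
        rwa [mem_preimage, this]
    rw [himage, hpre, hinv.measure_preimage (he.measurableSet_image.mpr hS).nullMeasurableSet]
  refine ⟨(ρ univ)⁻¹ • ρ, ⟨?_⟩, ?_, measurable_negBetaMap β, ?_⟩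
  · rw [Measure.smul_apply, smul_eq_mul]
    exact ENNReal.inv_mul_cancel (by simpa using hρne.out) (measure_ne_top _ _)
  · refine Measure.AbsolutelyContinuous.smul_left (Measure.AbsolutelyContinuous.mk
      fun S _ h0 => ?_) _
    rw [lebesgueIoc, he.comap_apply] at h0
    rw [hρ, he.comap_apply]
    exact hac h0
  · rw [Measure.map_smul, hρmap]

theorem corollaryc (β : ℝ) (hβ : 1 < β) :
    ∃ μ : Measure (Ioc (0 : ℝ) 1),
      IsACInvariantMeasure (negBetaMap β) lebesgueIoc μ ∧
      (∀ ν : Measure (Ioc (0 : ℝ) 1),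
        IsACInvariantMeasure (negBetaMap β) lebesgueIoc ν → ν = μ) ∧
      IsExactMap (negBetaMap β) μ := by
  obtain ⟨μ, hμ⟩ := exists_isACInvariantMeasure hβ
  exact ⟨μ, hμ, fun ν hν => eq_of_isACInvariantMeasure hβ hμ hν, isExactMap_negBetaMap hβ hμ⟩
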